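/- **Setting.** Let $T\ge 0$ and let $N$ tasks be given, task $n$ having generation time $a_n$, deadline $d_n$, duration $s_n$ and power requirement $p_n\ge 0$, with $0\le a_n\le d_n\le T$ and $0\le s_n\le d_n-a_n$. Let $C:[0,\infty)\to\mathbb R$ be nondecreasing, convex and differentiable (one-sidedly at $0$). Let $\mathcal F_n$ be the set of measurable functions $x_n$ with $0\le x_n(t)\le 1$ for all $t\in[0,T]$ and $\int_{a_n}^{d_n}x_n(t)\,dt=s_n$. The relaxed preemptive off-line problem is to minimize $\int_0^T C(\ell(t))\,dt$, where $\ell(t)=\sum_{n=1}^N p_nx_n(t)$ is the load, over all $X=(x_1,\dots,x_N)$ with $x_n\in\mathcal F_n$. **Algorithm.** Let $(i_k)$ be a sequence of task indices in which every task occurs infinitely often (for example the cyclic order $1,\dots,N,1,\dots,N,\dots$). Start from any feasible $X$. At step $k$, with $n=i_k$, replace $x_n$ by a minimizer over $x_n\in\mathcal F_n$ of $\int_0^T C\big(p_nx_n(t)+\sum_{j\ne n}p_jx_j(t)\big)\,dt$, all other $x_j$ being kept. Let $\ell^{(k)}$ be the resulting load functions. When $C$ is not strictly convex the minimizer need not be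 unique; a *most balanced* minimizer is one whose load $\ell=p_nx_n+\sum_{j\ne n}p_jx_j$ has the smallest value of $\int_0^T\ell(t)^2\,dt$ among all minimizers of the step. **Theorem 1.** The relaxed problem has an optimal solution, and at every feasible $X$ and for every task $n$ a (most balanced) minimizer exists. Moreover: 1. For every choice of the minimizers, the costs $\int_0^T C(\ell^{(k)}(t))\,dt$ converge to the optimal value. 2. If $C$ is strictly convex, then $\int_0^T|\ell^{(k)}(t)-\ell^*(t)|\,dt\to0$ for the load $\ell^*$ of any optimal solution. 3. For every $C$ as above, strictly convex or not, if each step picks a most balanced minimizer, then there is an optimal solution with load $\ell^*$ such that $\int_0^T|\ell^{(k)}(t)-\ell^*(t)|\,dt\to0$. -/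

import Mathlib

open MeasureTheory Filter Topology

noncomputable section

namespace LoadBalancing

/-- Admissible (relaxed, preemptive) activity functions of a task with generation time `a`,
deadline `d` and duration `s` over the horizon `[0, T]`: measurable functions with values
in `[0, 1]` on `[0, T]` whose integral over `[a, d]` is `s`. -/
def feasibleSet (T a d s : ℝ) : Set (ℝ → ℝ) :=
  {x | AEMeasurable x (volume.restrict (Set.Icc 0 T)) ∧
    (∀ t ∈ Set.Icc 0 T, 0 ≤ x t ∧ x t ≤ 1) ∧ ∫ t in a..d, x t = s}

/-- The power load at time `t` under the scheduling policy `X`. -/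
def load {N : ℕ} (p : Fin N → ℝ) (X : Fin N → ℝ → ℝ) (t : ℝ) : ℝ :=
  ∑ n, p n * X n t

/-- The total cost over the horizon `[0, T]` of a load function `l`. -/
def cost (C : ℝ → ℝ) (T : ℝ) (l : ℝ → ℝ) : ℝ :=
  ∫ t in (0 : ℝ)..T, C (l t)

/-- `X` is a feasible policy for the relaxed problem. -/
def IsFeasible {N : ℕ} (T : ℝ) (a d s : Fin N → ℝ) (X : Fin N → ℝ → ℝ) : Prop :=
  ∀ n, X n ∈ feasibleSet T (a n) (d n) (s n)

/-- `X` is an optimal solution of the relaxed problem. -/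
def IsOptimal {N : ℕ} (C : ℝ → ℝ) (T : ℝ) (a d s p : Fin N → ℝ) (X : Fin N → ℝ → ℝ) : Prop :=
  IsFeasible T a d s X ∧
    ∀ Y, IsFeasible T a d s Y → cost C T (load p X) ≤ cost C T (load p Y)

/-- `x` belongs to the argmin defining one step of the algorithm at the policy `X`:
it minimizes the cost over the admissible activity functions of task `n`, the activity
functions of the other tasks being those of `X`. -/
def IsUpdate {N : ℕ} (C : ℝ → ℝ) (T : ℝ) (a d s p : Fin N → ℝ) (X : Fin N → ℝ → ℝ)
    (n : Fin N) (x : ℝ → ℝ) : Prop :=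
  x ∈ feasibleSet T (a n) (d n) (s n) ∧
    ∀ y ∈ feasibleSet T (a n) (d n) (s n),
      cost C T (load p (Function.update X n x)) ≤ cost C T (load p (Function.update X n y))

/-- `x` is a most balanced element of the argmin: among all the minimizers of one step, its
load has the smallest integral of the square. -/
def IsBalancedUpdate {N : ℕ} (C : ℝ → ℝ) (T : ℝ) (a d s p : Fin N → ℝ) (X : Fin N → ℝ → ℝ)
    (n : Fin N) (x : ℝ → ℝ) : Prop :=
  IsUpdate C T a d s p X n x ∧
    ∀ y, IsUpdate C T a d s p X n y →
      cost (fun u => u ^ 2) T (load p (Function.update X n x)) ≤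
        cost (fun u => u ^ 2) T (load p (Function.update X n y))

/-- `X 0, X 1, …` is a run of the iterative load balancing algorithm: it starts from a feasible
policy, and step `k` replaces the activity function of task `i k` by a minimizer. -/
def IsRun {N : ℕ} (C : ℝ → ℝ) (T : ℝ) (a d s p : Fin N → ℝ) (i : ℕ → Fin N)
    (X : ℕ → Fin N → ℝ → ℝ) : Prop :=
  IsFeasible T a d s (X 0) ∧
    ∀ k, ∃ x, IsUpdate C T a d s p (X k) (i k) x ∧ X (k + 1) = Function.update (X k) (i k) x

/-- A run in which every step picks a most balanced minimizer. -/
def IsBalancedRun {N : ℕ} (C : ℝ → ℝ) (T : ℝ) (a d s p : Fin N → ℝ) (i : ℕ → Fin N)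
    (X : ℕ → Fin N → ℝ → ℝ) : Prop :=
  IsFeasible T a d s (X 0) ∧
    ∀ k, ∃ x, IsBalancedUpdate C T a d s p (X k) (i k) x ∧
      X (k + 1) = Function.update (X k) (i k) x

/-- Convergence in the mean (in `L¹[0, T]`) of a sequence of load functions. -/
def LoadsTendsto (T : ℝ) (l : ℕ → ℝ → ℝ) (m : ℝ → ℝ) : Prop :=
  Tendsto (fun k => ∫ t in (0 : ℝ)..T, |l k t - m t|) atTop (𝓝 0)

end LoadBalancing

end

/-! The algorithm is exact block descent for a convex functional of the load. The gap of a task is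
the largest first order decrease of the cost available to it. By convexity the sum of the gaps
bounds the distance of the cost to the optimum (`cost_sub_cost_le`), so it suffices that this sum
becomes arbitrarily small; monotonicity of the costs does the rest.

Two estimates, uniform over feasible policies, give this. An update at a large gap lowers the cost
by a definite amount (`exists_decrease`). While only tasks with small gaps are updated, the cost
does not rise, so the Bregman distance travelled by the load is at most the sum of these gaps
(`bregman_load_le`); then the subgradients, and with them the gaps of the other tasks, hardly move
(`gap_le_gap_add`). If the total gap stayed away from zero, at a cluster point of the gap vectors
some gaps vanish and the others do not. The next update of a task of the second kind still meets a
large gap and pushes the cost below its limit (`exists_sum_gap_lt`). Only gap vectors need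
compactness, not policies.

For strictly convex costs, uniform convexity turns convergence of costs into convergence of loads.
The general case reduces to the square: a water filling activity minimizes a step for every cost at
once (`exists_common_update`). Hence a balanced run is a run for the quadratic cost, and a quadratic
optimum, which exists by a Hilbert space argument, is optimal for every cost. -/

namespace LoadBalancing

/-! ### Subgradients and quantitative convexity on bounded intervals. -/

/-- `G` is a continuous nonnegative selection of subgradients of `C` on `[0, ∞)`. -/
structure IsSubgradient (C G : ℝ → ℝ) : Prop where
  continuousOn : ContinuousOn C (Set.Ici 0)
  continuousOn_grad : ContinuousOn G (Set.Ici 0)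
  add_mul_le : ∀ u v, 0 ≤ u → 0 ≤ v → C v + G v * (u - v) ≤ C u
  nonneg : ∀ u, 0 ≤ u → 0 ≤ G u

lemma IsSubgradient.mono {C G : ℝ → ℝ} (h : IsSubgradient C G) {u v : ℝ} (hu : 0 ≤ u)
    (huv : u ≤ v) : G u ≤ G v := by
  rcases huv.eq_or_lt with rfl | hlt
  · exact le_rfl
  have h1 := h.add_mul_le u v hu (hu.trans huv)
  have h2 := h.add_mul_le v u (hu.trans huv) hu
  nlinarith

/-- The derivative of a convex function that is differentiable on `[0, ∞)` is continuous there. -/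
lemma continuousOn_derivWithin_of_convexOn {C : ℝ → ℝ} (hconv : ConvexOn ℝ (Set.Ici 0) C)
    (hdiff : DifferentiableOn ℝ C (Set.Ici 0)) :
    ContinuousOn (derivWithin C (Set.Ici 0)) (Set.Ici 0) := by
  set G := derivWithin C (Set.Ici 0)
  have hmono : MonotoneOn G (Set.Ici 0) := hconv.monotoneOn_derivWithin hdiff
  have hder : ∀ x ∈ Set.Ici (0 : ℝ), HasDerivWithinAt C (G x) (Set.Ici 0) x :=
    fun x hx => (hdiff x hx).hasDerivWithinAt
  -- Darboux: a derivative has the intermediate value property, and a monotone function with this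
  -- property has no jumps.
  have himg : ∀ u v, 0 ≤ u → u ≤ v → ∀ c, G u ≤ c → c ≤ G v → ∃ w, u ≤ w ∧ w ≤ v ∧ G w = c := by
    intro u v hu huv c h1 h2
    have h := Set.ordConnected_Icc.image_hasDerivWithinAt (f := C) (f' := G) (s := Set.Icc u v)
      (fun x hx => (hder x (hu.trans hx.1)).mono fun y hy => hu.trans hy.1)
    obtain ⟨w, hw, rfl⟩ := h.out (Set.mem_image_of_mem G (Set.left_mem_Icc.2 huv))
      (Set.mem_image_of_mem G (Set.right_mem_Icc.2 huv)) ⟨h1, h2⟩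
    exact ⟨w, hw.1, hw.2, rfl⟩
  intro v hv
  rw [Metric.continuousWithinAt_iff]
  intro ε hε
  have hv0 : (0 : ℝ) ≤ v := hv
  have right : ∃ δ > 0, ∀ u, v ≤ u → u < v + δ → G u < G v + ε := by
    by_cases h : G (v + 1) < G v + ε
    · refine ⟨1, one_pos, fun u h1 h2 => lt_of_le_of_lt ?_ h⟩
      exact hmono (hv0.trans h1) (by simp; linarith) h2.le
    · obtain ⟨w, hw1, hw2, hw⟩ := himg v (v + 1) hv0 (by linarith) (G v + ε / 2) (by linarith)
        (by linarith)
      have : v < w := lt_of_le_of_ne hw1 (by rintro rfl; linarith)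
      refine ⟨w - v, by linarith, fun u h1 h2 => ?_⟩
      have := hmono (a := u) (b := w) (hv0.trans h1) (hv0.trans hw1) (by linarith)
      linarith
  have left : ∃ δ > 0, ∀ u, 0 ≤ u → u ≤ v → v - δ < u → G v - ε < G u := by
    by_cases h : G v - ε < G 0
    · refine ⟨1, one_pos, fun u h0 h1 h2 => h.trans_le ?_⟩
      exact hmono (by simp) h0 h0
    · obtain ⟨w, hw1, hw2, hw⟩ := himg 0 v le_rfl hv0 (G v - ε / 2) (by linarith)
        (by linarith)
      have : w < v := lt_of_le_of_ne hw2 (by rintro rfl; linarith)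
      refine ⟨v - w, by linarith, fun u h0 h1 h2 => ?_⟩
      have := hmono (a := w) (b := u) hw1 h0 (by linarith)
      linarith
  obtain ⟨δ₁, hδ₁, h1⟩ := right
  obtain ⟨δ₂, hδ₂, h2⟩ := left
  refine ⟨min δ₁ δ₂, lt_min hδ₁ hδ₂, fun u hu hd => ?_⟩
  rw [Real.dist_eq, abs_lt] at *
  have := min_le_left δ₁ δ₂
  have := min_le_right δ₁ δ₂
  rcases le_total v u with hvu | huv
  · have a1 := h1 u hvu (by linarith)
    have a2 := hmono hv hu hvu
    constructor <;> linarith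
  · have a1 := h2 u hu huv (by linarith)
    have a2 := hmono hu hv huv
    constructor <;> linarith

lemma isSubgradient_derivWithin {C : ℝ → ℝ} (hmono : MonotoneOn C (Set.Ici 0))
    (hconv : ConvexOn ℝ (Set.Ici 0) C) (hdiff : DifferentiableOn ℝ C (Set.Ici 0)) :
    IsSubgradient C (derivWithin C (Set.Ici 0)) where
  continuousOn := hdiff.continuousOn
  continuousOn_grad := continuousOn_derivWithin_of_convexOn hconv hdiff
  add_mul_le u v hu hv := by
    rcases lt_trichotomy u v with h | rfl | h
    · have := hconv.slope_le_derivWithin hu hv h (hdiff v hv)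
      rw [slope_def_field, div_le_iff₀ (by linarith)] at this
      linarith
    · simp
    · have := hconv.derivWithin_le_slope hv hu h (hdiff v hv)
      rw [slope_def_field, le_div_iff₀ (by linarith)] at this
      linarith
  nonneg u _ := hmono.derivWithin_nonneg

/-- Makes the whole theory available for the quadratic cost, to which balanced runs are reduced. -/
lemma isSubgradient_sq : IsSubgradient (fun u => u ^ 2) (fun u => 2 * u) where
  continuousOn := by fun_prop
  continuousOn_grad := by fun_prop
  add_mul_le u v _ _ := by nlinarith [sq_nonneg (u - v)]
  nonneg u hu := by positivity

lemma strictConvexOn_sq : StrictConvexOn ℝ (Set.Ici (0 : ℝ)) fun u => u ^ 2 :=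
  (even_two.strictConvexOn_pow two_ne_zero).subset (Set.subset_univ _) (convex_Ici 0)

/-- Uniform continuity of the subgradients on a bounded interval. -/
lemma IsSubgradient.exists_modulus {C G : ℝ → ℝ} (h : IsSubgradient C G) (P : ℝ) {η : ℝ}
    (hη : 0 < η) : ∃ r > 0, ∀ u ∈ Set.Icc 0 P, ∀ v ∈ Set.Icc 0 P, |u - v| < r →
      |G u - G v| < η := by
  have huc := isCompact_Icc.uniformContinuousOn_of_continuous
    (h.continuousOn_grad.mono (Set.Icc_subset_Ici_self : Set.Icc 0 P ⊆ Set.Ici 0))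
  obtain ⟨r, hr, H⟩ := Metric.uniformContinuousOn_iff.1 huc η hη
  exact ⟨r, hr, fun u hu v hv huv => H u hu v hv huv⟩

/-- The Bregman distance controls the distance of the subgradients. -/
lemma IsSubgradient.abs_sub_le_bregman {C G : ℝ → ℝ} (h : IsSubgradient C G) (P : ℝ) {η : ℝ}
    (hη : 0 < η) : ∃ K, 0 ≤ K ∧ ∀ u ∈ Set.Icc 0 P, ∀ v ∈ Set.Icc 0 P,
      |G u - G v| ≤ η + K * (C u - C v - G v * (u - v)) := by
  obtain ⟨r, hr, H⟩ := h.exists_modulus P (half_pos hη)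
  rcases lt_or_ge P 0 with hP | hP
  · exact ⟨0, le_rfl, fun u hu => absurd (hu.1.trans hu.2) (by linarith)⟩
  have hM : 0 ≤ G P := h.nonneg P hP
  have hc : 0 < η / 2 * (r / 2) := by positivity
  -- The difference of subgradients never exceeds `G P`, and it exceeds `η` only where the Bregman
  -- distance is at least `η / 2 * (r / 2)`.
  refine ⟨G P / (η / 2 * (r / 2)), by positivity, fun u hu v hv => ?_⟩
  have hD : 0 ≤ C u - C v - G v * (u - v) := by
    linarith [h.add_mul_le u v hu.1 hv.1]
  by_cases hle : |G u - G v| ≤ η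
  · have : 0 ≤ G P / (η / 2 * (r / 2)) * (C u - C v - G v * (u - v)) := by positivity
    linarith
  push Not at hle
  have hbig : r ≤ |u - v| := by
    by_contra hlt
    push Not at hlt
    linarith [H u hu v hv hlt]
  have hGle : |G u - G v| ≤ G P := by
    have a1 := h.mono hu.1 hu.2
    have a2 := h.mono hv.1 hv.2
    have a3 := h.nonneg u hu.1
    have a4 := h.nonneg v hv.1
    rw [abs_le]; constructor <;> linarith
  -- Let `w` lie at distance `r / 2` from `u` towards `v`. Chaining the tangent inequalities through
  -- `w` bounds the Bregman distance below by `(G w - G v) * (u - w)`, and `G w` is still more than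
  -- `η / 2` away from `G v`.
  have key : η / 2 * (r / 2) ≤ C u - C v - G v * (u - v) := by
    rcases le_total v u with hvu | huv
    · rw [abs_of_nonneg (by linarith)] at hbig
      have hGG := h.mono hv.1 hvu
      rw [abs_of_nonneg (by linarith)] at hle
      have hw : u - r / 2 ∈ Set.Icc 0 P := ⟨by linarith [hv.1], by linarith [hu.2]⟩
      have a1 := h.add_mul_le u (u - r / 2) hu.1 hw.1
      have a2 := h.add_mul_le (u - r / 2) v hw.1 hv.1
      have a3 := (abs_lt.1 (H u hu _ hw (by rw [abs_lt]; constructor <;> linarith))).2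
      nlinarith
    · rw [abs_sub_comm, abs_of_nonneg (by linarith)] at hbig
      have hGG := h.mono hu.1 huv
      rw [abs_sub_comm, abs_of_nonneg (by linarith)] at hle
      have hw : u + r / 2 ∈ Set.Icc 0 P := ⟨by linarith [hu.1], by linarith [hv.2]⟩
      have a1 := h.add_mul_le u (u + r / 2) hu.1 hw.1
      have a2 := h.add_mul_le (u + r / 2) v hw.1 hv.1
      have a3 := (abs_lt.1 (H u hu _ hw (by rw [abs_lt]; constructor <;> linarith))).1
      nlinarith
  have : G P ≤ G P / (η / 2 * (r / 2)) * (C u - C v - G v * (u - v)) := by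
    rw [div_mul_eq_mul_div, le_div_iff₀ hc]
    exact mul_le_mul_of_nonneg_left key hM
  linarith

/-- Uniform convexity of a strictly convex function on a bounded interval. -/
lemma abs_sub_le_of_strictConvexOn {C : ℝ → ℝ} (hC : StrictConvexOn ℝ (Set.Ici 0) C)
    (hcont : ContinuousOn C (Set.Ici 0)) (P : ℝ) {η : ℝ} (hη : 0 < η) :
    ∃ K, 0 ≤ K ∧ ∀ u ∈ Set.Icc 0 P, ∀ v ∈ Set.Icc 0 P,
      |u - v| ≤ η + K * ((C u + C v) / 2 - C ((u + v) / 2)) := by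
  have hmid : ∀ u v : ℝ, 0 ≤ u → 0 ≤ v → u ≠ v → 0 < (C u + C v) / 2 - C ((u + v) / 2) := by
    intro u v hu hv huv
    have := hC.2 hu hv huv (show (0 : ℝ) < 1 / 2 by norm_num)
      (show (0 : ℝ) < 1 / 2 by norm_num) (by norm_num)
    simp only [smul_eq_mul] at this
    rw [show (1 / 2 * u + 1 / 2 * v : ℝ) = (u + v) / 2 by ring] at this
    linarith
  have hmid' : ∀ u v : ℝ, 0 ≤ u → 0 ≤ v → 0 ≤ (C u + C v) / 2 - C ((u + v) / 2) := by
    intro u v hu hv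
    rcases eq_or_ne u v with rfl | huv
    · simp
    · exact (hmid u v hu hv huv).le
  -- Off the diagonal strip the midpoint deficit has a positive minimum by compactness; inside the
  -- strip the additive `η` suffices.
  let S : Set (ℝ × ℝ) := (Set.Icc 0 P ×ˢ Set.Icc 0 P) ∩ {z | η ≤ |z.1 - z.2|}
  have hS : IsCompact S := (isCompact_Icc.prod isCompact_Icc).inter_right
    (isClosed_le continuous_const (by fun_prop))
  have hφ : ContinuousOn (fun z : ℝ × ℝ => (C z.1 + C z.2) / 2 - C ((z.1 + z.2) / 2)) S := by
    refine ContinuousOn.sub (ContinuousOn.div_const (ContinuousOn.add ?_ ?_) 2) ?_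
    · exact hcont.comp (by fun_prop) fun z hz => hz.1.1.1
    · exact hcont.comp (by fun_prop) fun z hz => hz.1.2.1
    · refine hcont.comp (by fun_prop) fun z hz => ?_
      have a1 := hz.1.1.1
      have a2 := hz.1.2.1
      simp only [Set.mem_Ici]; linarith
  rcases S.eq_empty_or_nonempty with hemp | hne
  · refine ⟨0, le_rfl, fun u hu v hv => ?_⟩
    by_contra hlt
    push Not at hlt
    have : (u, v) ∈ S := ⟨⟨hu, hv⟩, by simp only [Set.mem_ofPred_eq]; linarith⟩
    simp [hemp] at this
  · obtain ⟨z, hz, hmin⟩ := hS.exists_isMinOn hne hφ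
    set δ := (C z.1 + C z.2) / 2 - C ((z.1 + z.2) / 2) with hδ
    have hδ0 : 0 < δ := by
      refine hmid _ _ hz.1.1.1 hz.1.2.1 fun heq => ?_
      have : η ≤ |z.1 - z.2| := hz.2
      rw [heq, sub_self, abs_zero] at this
      linarith
    have hP : 0 ≤ P := hz.1.1.1.trans hz.1.1.2
    refine ⟨P / δ, by positivity, fun u hu v hv => ?_⟩
    by_cases hlt : η ≤ |u - v|
    · have h1 : δ ≤ (C u + C v) / 2 - C ((u + v) / 2) :=
        hmin (show (u, v) ∈ S from ⟨⟨hu, hv⟩, hlt⟩)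
      have h2 : |u - v| ≤ P := by
        rw [abs_le]; constructor <;> linarith [hu.1, hu.2, hv.1, hv.2]
      have h3 : P ≤ P / δ * ((C u + C v) / 2 - C ((u + v) / 2)) := by
        rw [div_mul_eq_mul_div, le_div_iff₀ hδ0]
        exact mul_le_mul_of_nonneg_left h1 hP
      linarith
    · have : 0 ≤ P / δ * ((C u + C v) / 2 - C ((u + v) / 2)) :=
        mul_nonneg (by positivity) (hmid' u v hu.1 hv.1)
      linarith

/-! ### The abstract convergence principle. -/

/-- Convergence principle for block descent: if updating a block with a large gap decreases `F` by
a definite amount, and updates of blocks with small gaps hardly affect the gaps of the other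
blocks, then the total gap becomes arbitrarily small along the run, provided that every block is
updated infinitely often. -/
lemma exists_sum_gap_lt {N : ℕ} (F : ℕ → ℝ) (γ : ℕ → Fin N → ℝ) (i : ℕ → Fin N) (B : ℝ)
    (hi : ∀ n, ∃ᶠ k in atTop, i k = n) (hF : Antitone F) (hFb : BddBelow (Set.range F))
    (hγ : ∀ k n, γ k n ∈ Set.Icc 0 B)
    (hdec : ∀ ε > 0, ∃ δ > 0, ∀ k, ε ≤ γ k (i k) → δ ≤ F k - F (k + 1))
    (hpers : ∀ ε > 0, ∃ δ > 0, ∀ (U : Finset (Fin N)) (k m : ℕ), k ≤ m →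
      (∀ j, k ≤ j → j < m → i j ∈ U) → ∑ n ∈ U, γ k n ≤ δ → ∀ n ∉ U, γ k n - ε ≤ γ m n) :
    ∀ ε > 0, ∃ k, ∑ n, γ k n < ε := by
  intro ε hε
  by_contra! hcon
  obtain ⟨g, -, φ, hφ, hlim⟩ := (isCompact_univ_pi fun _ : Fin N =>
    (isCompact_Icc : IsCompact (Set.Icc 0 B))).tendsto_subseq (x := γ) fun k n _ => hγ k n
  have hlim' : ∀ n, Tendsto (fun k => γ (φ k) n) atTop (𝓝 (g n)) := fun n =>
    (tendsto_pi_nhds.1 hlim) n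
  have hg0 : ∀ n, 0 ≤ g n := fun n =>
    ge_of_tendsto' (hlim' n) fun k => (hγ (φ k) n).1
  classical
  let U : Finset (Fin N) := Finset.univ.filter fun n => g n = 0
  have hsum : ε ≤ ∑ n, g n :=
    ge_of_tendsto' (tendsto_finsetSum _ fun n _ => hlim' n) fun k => hcon (φ k)
  have hUc : (Uᶜ).Nonempty := by
    by_contra hne
    rw [Finset.not_nonempty_iff_eq_empty, Finset.compl_eq_empty_iff] at hne
    have : ∑ n, g n = 0 := Finset.sum_eq_zero fun n hn => by
      have : n ∈ U := hne ▸ Finset.mem_univ n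
      exact (Finset.mem_filter.1 this).2
    linarith
  obtain ⟨n₀, hn₀, hmin⟩ := Finset.exists_min_image Uᶜ g hUc
  have hpos : 0 < g n₀ := by
    refine lt_of_le_of_ne (hg0 n₀) fun h => ?_
    exact (Finset.mem_compl.1 hn₀) (Finset.mem_filter.2 ⟨Finset.mem_univ _, h.symm⟩)
  -- Late in the subsequence every gap outside `U` exceeds `g n₀ / 2`. It loses at most `g n₀ / 4`
  -- before the first update outside `U`, so that update lowers `F` by `δ₁`, from below `L + δ₁` to
  -- below the limit `L`.
  obtain ⟨δ₁, hδ₁, hdec'⟩ := hdec (g n₀ / 4) (by positivity)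
  obtain ⟨δ₂, hδ₂, hpers'⟩ := hpers (g n₀ / 4) (by positivity)
  have hFlim := tendsto_atTop_ciInf hF hFb
  set L := ⨅ k, F k
  have hL : ∀ k, L ≤ F k := fun k => ciInf_le hFb k
  have e1 : ∀ᶠ k in atTop, F (φ k) < L + δ₁ :=
    (hFlim.comp hφ.tendsto_atTop).eventually_lt_const (by linarith)
  have e2 : ∀ᶠ k in atTop, ∑ n ∈ U, γ (φ k) n < δ₂ := by
    have h0 : Tendsto (fun k => ∑ n ∈ U, γ (φ k) n) atTop (𝓝 (∑ n ∈ U, g n)) :=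
      tendsto_finsetSum _ fun n _ => hlim' n
    have h1 : ∑ n ∈ U, g n = 0 := Finset.sum_eq_zero fun n hn => (Finset.mem_filter.1 hn).2
    rw [h1] at h0
    exact h0.eventually_lt_const hδ₂
  have e3 : ∀ᶠ k in atTop, ∀ n, n ∈ Uᶜ → g n₀ / 2 < γ (φ k) n := by
    rw [eventually_all]
    intro n
    by_cases hn : n ∈ Uᶜ
    · have := hmin n hn
      filter_upwards [(hlim' n).eventually_const_lt (show g n₀ / 2 < g n by linarith)] with k hk _
      exact hk
    · exact Eventually.of_forall fun k h => absurd h hn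
  obtain ⟨k, h1, h2, h3⟩ := (e1.and (e2.and e3)).exists
  have hex : ∃ m, φ k ≤ m ∧ i m ∉ U := by
    obtain ⟨m, hm, him⟩ := frequently_atTop.1 (hi n₀) (φ k)
    exact ⟨m, hm, him ▸ Finset.mem_compl.1 hn₀⟩
  have hfind := Nat.find_spec hex
  set m := Nat.find hex
  have hbefore : ∀ j, φ k ≤ j → j < m → i j ∈ U := fun j hj hjm => by
    by_contra hn
    exact Nat.find_min hex hjm ⟨hj, hn⟩
  have hgap := hpers' U (φ k) m hfind.1 hbefore h2.le (i m) hfind.2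
  have hbig := h3 (i m) (Finset.mem_compl.2 hfind.2)
  have hd := hdec' m (by linarith)
  have := hF hfind.1
  have := hL (m + 1)
  linarith

/-! ### Bounded loads and the integrated Bregman distance. -/

/-- Measurable functions on `[0, T]` with values in `[0, P]`. -/
structure IsBoundedLoad (T P : ℝ) (l : ℝ → ℝ) : Prop where
  aemeasurable : AEMeasurable l (volume.restrict (Set.Icc 0 T))
  mem : ∀ t ∈ Set.Icc 0 T, l t ∈ Set.Icc 0 P

lemma integrableOn_of_abs_le {T B : ℝ} {f : ℝ → ℝ}
    (hf : AEMeasurable f (volume.restrict (Set.Icc 0 T))) (hB : ∀ t ∈ Set.Icc 0 T, |f t| ≤ B) :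
    IntegrableOn f (Set.Icc 0 T) :=
  Integrable.of_bound hf.aestronglyMeasurable B
    ((ae_restrict_iff' measurableSet_Icc).2 (Eventually.of_forall hB))

lemma setIntegral_mono_Icc {T : ℝ} {f g : ℝ → ℝ} (hf : IntegrableOn f (Set.Icc 0 T))
    (hg : IntegrableOn g (Set.Icc 0 T)) (h : ∀ t ∈ Set.Icc 0 T, f t ≤ g t) :
    ∫ t in Set.Icc 0 T, f t ≤ ∫ t in Set.Icc 0 T, g t :=
  setIntegral_mono_on hf hg measurableSet_Icc h

lemma setIntegral_Icc_const {T : ℝ} (hT : 0 ≤ T) (c : ℝ) : ∫ _ in Set.Icc 0 T, c = T * c := by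
  simp [hT]

lemma IsBoundedLoad.aemeasurable_comp {T P : ℝ} {l φ : ℝ → ℝ} (hl : IsBoundedLoad T P l)
    (hφ : ContinuousOn φ (Set.Ici 0)) :
    AEMeasurable (fun t => φ (l t)) (volume.restrict (Set.Icc 0 T)) := by
  -- Continuity is known only on `[0, ∞)`; the extension by `max u 0` is continuous on the line and
  -- agrees with `φ` on the values of the load.
  have hc : Continuous fun u : ℝ => φ (max u 0) :=
    hφ.comp_continuous (by fun_prop) fun u => Set.mem_Ici.2 (le_max_right _ _)
  refine (hc.measurable.comp_aemeasurable hl.aemeasurable).congr ?_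
  refine (ae_restrict_iff' measurableSet_Icc).2 (Eventually.of_forall fun t ht => ?_)
  simp [(hl.mem t ht).1]

lemma exists_abs_le_of_continuousOn {φ : ℝ → ℝ} (hφ : ContinuousOn φ (Set.Ici 0)) (P : ℝ) :
    ∃ B, ∀ u ∈ Set.Icc 0 P, |φ u| ≤ B := by
  obtain ⟨B, hB⟩ := isCompact_Icc.exists_bound_of_continuousOn
    (hφ.mono (Set.Icc_subset_Ici_self : Set.Icc 0 P ⊆ Set.Ici 0))
  exact ⟨B, hB⟩

lemma IsBoundedLoad.integrableOn_comp {T P : ℝ} {l φ : ℝ → ℝ} (hl : IsBoundedLoad T P l)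
    (hφ : ContinuousOn φ (Set.Ici 0)) : IntegrableOn (fun t => φ (l t)) (Set.Icc 0 T) := by
  obtain ⟨B, hB⟩ := exists_abs_le_of_continuousOn hφ P
  exact integrableOn_of_abs_le (hl.aemeasurable_comp hφ) fun t ht => hB _ (hl.mem t ht)

lemma IsBoundedLoad.integrableOn {T P : ℝ} {l : ℝ → ℝ} (hl : IsBoundedLoad T P l) :
    IntegrableOn l (Set.Icc 0 T) :=
  hl.integrableOn_comp (φ := fun u => u) continuousOn_id

lemma IsBoundedLoad.integrableOn_comp_mul {T P : ℝ} {l φ h : ℝ → ℝ} (hl : IsBoundedLoad T P l)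
    (hφ : ContinuousOn φ (Set.Ici 0)) (hh : IntegrableOn h (Set.Icc 0 T)) :
    IntegrableOn (fun t => φ (l t) * h t) (Set.Icc 0 T) := by
  obtain ⟨B, hB⟩ := exists_abs_le_of_continuousOn hφ P
  exact Integrable.bdd_mul (c := B) hh (hl.aemeasurable_comp hφ).aestronglyMeasurable
    ((ae_restrict_iff' measurableSet_Icc).2 (Eventually.of_forall fun t ht => hB _ (hl.mem t ht)))

lemma cost_eq {T : ℝ} (hT : 0 ≤ T) (C l : ℝ → ℝ) :
    cost C T l = ∫ t in Set.Icc 0 T, C (l t) := by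
  rw [cost, intervalIntegral.integral_of_le hT, integral_Icc_eq_integral_Ioc]

/-- The integrated Bregman distance of two loads. -/
noncomputable def bregman (C G : ℝ → ℝ) (T : ℝ) (m l : ℝ → ℝ) : ℝ :=
  ∫ t in Set.Icc 0 T, (C (m t) - C (l t) - G (l t) * (m t - l t))

lemma IsSubgradient.bregman_nonneg {C G : ℝ → ℝ} (h : IsSubgradient C G) {T P : ℝ} {m l : ℝ → ℝ}
    (hm : IsBoundedLoad T P m) (hl : IsBoundedLoad T P l) : 0 ≤ bregman C G T m l :=
  setIntegral_nonneg measurableSet_Icc fun t ht => by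
    linarith [h.add_mul_le (m t) (l t) (hm.mem t ht).1 (hl.mem t ht).1]

lemma IsSubgradient.bregman_eq {C G : ℝ → ℝ} (h : IsSubgradient C G) {T P : ℝ} (hT : 0 ≤ T)
    {m l : ℝ → ℝ} (hm : IsBoundedLoad T P m) (hl : IsBoundedLoad T P l) :
    bregman C G T m l =
      cost C T m - cost C T l - ∫ t in Set.Icc 0 T, G (l t) * (m t - l t) := by
  have h1 := hm.integrableOn_comp h.continuousOn
  have h2 := hl.integrableOn_comp h.continuousOn
  have h3 := hl.integrableOn_comp_mul h.continuousOn_grad (hm.integrableOn.sub hl.integrableOn)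
  rw [cost_eq hT, cost_eq hT, bregman, ← integral_sub h1 h2]
  exact integral_sub (h1.sub h2) h3

/-- Loads at a small Bregman distance have subgradients that are close in the mean. -/
lemma IsSubgradient.integral_abs_sub_le {C G : ℝ → ℝ} (h : IsSubgradient C G) {T : ℝ}
    (hT : 0 ≤ T) (P : ℝ) {ε : ℝ} (hε : 0 < ε) :
    ∃ δ > 0, ∀ m l, IsBoundedLoad T P m → IsBoundedLoad T P l → bregman C G T m l ≤ δ →
      ∫ t in Set.Icc 0 T, |G (m t) - G (l t)| ≤ ε := by
  -- The constants make the additive term and the Bregman term contribute at most `ε / 2` each; the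
  -- `+ 1` avoids division by zero.
  obtain ⟨K, hK, H⟩ := h.abs_sub_le_bregman P (η := ε / (2 * (T + 1))) (by positivity)
  refine ⟨ε / (2 * (K + 1)), by positivity, fun m l hm hl hδ => ?_⟩
  have h1 := hm.integrableOn_comp h.continuousOn
  have h2 := hl.integrableOn_comp h.continuousOn
  have h3 := hl.integrableOn_comp_mul h.continuousOn_grad (hm.integrableOn.sub hl.integrableOn)
  have h4 : IntegrableOn (fun t => C (m t) - C (l t) - G (l t) * (m t - l t)) (Set.Icc 0 T) :=
    (h1.sub h2).sub h3
  have h5 : IntegrableOn (fun t => |G (m t) - G (l t)|) (Set.Icc 0 T) :=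
    ((hm.integrableOn_comp h.continuousOn_grad).sub (hl.integrableOn_comp h.continuousOn_grad)).abs
  have hc : IntegrableOn (fun _ : ℝ => ε / (2 * (T + 1))) (Set.Icc 0 T) :=
    integrableOn_const (by simp)
  have key := setIntegral_mono_Icc h5 (hc.add (h4.const_mul K))
    fun t ht => H _ (hm.mem t ht) _ (hl.mem t ht)
  have e := integral_add hc (h4.const_mul K)
  simp only [Pi.add_apply] at key
  rw [e, setIntegral_Icc_const hT, integral_const_mul] at key
  have a1 : T * (ε / (2 * (T + 1))) ≤ ε / 2 := by
    rw [mul_div_assoc', div_le_div_iff₀ (by positivity) (by positivity)]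
    nlinarith
  have a2 : K * (ε / (2 * (K + 1))) ≤ ε / 2 := by
    rw [mul_div_assoc', div_le_div_iff₀ (by positivity) (by positivity)]
    nlinarith
  have a3 := mul_le_mul_of_nonneg_left hδ hK
  rw [bregman] at a3
  linarith

/-! ### Feasible policies and their loads. -/

lemma integrableOn_of_mem_feasibleSet {T a d s : ℝ} {x : ℝ → ℝ} (hx : x ∈ feasibleSet T a d s) :
    IntegrableOn x (Set.Icc 0 T) :=
  integrableOn_of_abs_le hx.1 (B := 1) fun t ht => by
    rw [abs_of_nonneg (hx.2.1 t ht).1]; exact (hx.2.1 t ht).2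

lemma integral_eq_setIntegral_of_mem_feasibleSet {T a d s : ℝ} {x : ℝ → ℝ} (had : a ≤ d)
    (hx : x ∈ feasibleSet T a d s) : ∫ t in Set.Icc a d, x t = s := by
  rw [integral_Icc_eq_integral_Ioc, ← intervalIntegral.integral_of_le had]
  exact hx.2.2

lemma mem_feasibleSet_of_setIntegral {T a d s : ℝ} {x : ℝ → ℝ} (had : a ≤ d)
    (hm : AEMeasurable x (volume.restrict (Set.Icc 0 T)))
    (h01 : ∀ t ∈ Set.Icc 0 T, 0 ≤ x t ∧ x t ≤ 1) (hx : ∫ t in Set.Icc a d, x t = s) :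
    x ∈ feasibleSet T a d s := by
  refine ⟨hm, h01, ?_⟩
  rw [intervalIntegral.integral_of_le had, ← integral_Icc_eq_integral_Ioc, hx]

lemma lineMap_mem_feasibleSet {T a d s : ℝ} (ha : 0 ≤ a) (had : a ≤ d) (hd : d ≤ T)
    {x y : ℝ → ℝ} (hx : x ∈ feasibleSet T a d s) (hy : y ∈ feasibleSet T a d s) {r : ℝ}
    (h0 : 0 ≤ r) (h1 : r ≤ 1) :
    (fun t => (1 - r) * x t + r * y t) ∈ feasibleSet T a d s := by
  have hsub : Set.Icc a d ⊆ Set.Icc 0 T := Set.Icc_subset_Icc ha hd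
  refine mem_feasibleSet_of_setIntegral had ((hx.1.const_mul _).add (hy.1.const_mul _)) ?_ ?_
  · intro t ht
    have := hx.2.1 t ht
    have := hy.2.1 t ht
    constructor <;> nlinarith
  · rw [integral_add (((integrableOn_of_mem_feasibleSet hx).mono_set hsub).const_mul _)
      (((integrableOn_of_mem_feasibleSet hy).mono_set hsub).const_mul _), integral_const_mul,
      integral_const_mul, integral_eq_setIntegral_of_mem_feasibleSet had hx,
      integral_eq_setIntegral_of_mem_feasibleSet had hy]
    ring

lemma IsFeasible.update {N : ℕ} {T : ℝ} {a d s : Fin N → ℝ} {X : Fin N → ℝ → ℝ}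
    (hX : IsFeasible T a d s X) {n : Fin N} {y : ℝ → ℝ}
    (hy : y ∈ feasibleSet T (a n) (d n) (s n)) : IsFeasible T a d s (Function.update X n y) := by
  intro j
  rcases eq_or_ne j n with rfl | hj
  · simpa using hy
  · simpa [hj] using hX j

lemma IsFeasible.isBoundedLoad {N : ℕ} {T : ℝ} {a d s p : Fin N → ℝ} {X : Fin N → ℝ → ℝ}
    (hX : IsFeasible T a d s X) (hp : ∀ n, 0 ≤ p n) :
    IsBoundedLoad T (∑ n, p n) (load p X) where
  aemeasurable := by
    unfold load
    exact Finset.aemeasurable_fun_sum _ fun n _ => (hX n).1.const_mul _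
  mem t ht := by
    refine ⟨Finset.sum_nonneg fun n _ => mul_nonneg (hp n) ((hX n).2.1 t ht).1,
      Finset.sum_le_sum fun n _ => ?_⟩
    nlinarith [hp n, ((hX n).2.1 t ht).2]

lemma load_update {N : ℕ} (p : Fin N → ℝ) (X : Fin N → ℝ → ℝ) (n : Fin N) (y : ℝ → ℝ) (t : ℝ) :
    load p (Function.update X n y) t = load p X t + p n * (y t - X n t) := by
  have h : ∀ j, p j * Function.update X n y j t =
      p j * X j t + if j = n then p n * (y t - X n t) else 0 := by
    intro j
    rcases eq_or_ne j n with rfl | hj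
    · simp; ring
    · simp [hj]
  simp only [load, h, Finset.sum_add_distrib, Finset.sum_ite_eq', Finset.mem_univ, if_true]

/-! ### Gaps: optimality bound, persistence and decrease. -/

/-- First order decrease of the cost when the activity of task `n` is moved towards `y`. -/
noncomputable def linearDecrease {N : ℕ} (G : ℝ → ℝ) (T : ℝ) (p : Fin N → ℝ) (X : Fin N → ℝ → ℝ) (n : Fin N)
    (y : ℝ → ℝ) : ℝ :=
  ∫ t in Set.Icc 0 T, G (load p X t) * (p n * (X n t - y t))

/-- The largest first order decrease of the cost available to task `n`. -/
noncomputable def gap {N : ℕ} (G : ℝ → ℝ) (T : ℝ) (a d s p : Fin N → ℝ) (X : Fin N → ℝ → ℝ) (n : Fin N) : ℝ :=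
  sSup (linearDecrease G T p X n '' feasibleSet T (a n) (d n) (s n))

section Gap

variable {N : ℕ} {T : ℝ} {a d s p : Fin N → ℝ} {C G : ℝ → ℝ} {X Y : Fin N → ℝ → ℝ}

lemma IsFeasible.integrableOn_mul_sub (hX : IsFeasible T a d s X) {n : Fin N} {y : ℝ → ℝ}
    (hy : y ∈ feasibleSet T (a n) (d n) (s n)) :
    IntegrableOn (fun t => p n * (X n t - y t)) (Set.Icc 0 T) :=
  ((integrableOn_of_mem_feasibleSet (hX n)).sub (integrableOn_of_mem_feasibleSet hy)).const_mul _

lemma IsFeasible.abs_mul_sub_le (hX : IsFeasible T a d s X) (hp : ∀ n, 0 ≤ p n) {n : Fin N}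
    {y : ℝ → ℝ} (hy : y ∈ feasibleSet T (a n) (d n) (s n)) {t : ℝ} (ht : t ∈ Set.Icc 0 T) :
    |p n * (X n t - y t)| ≤ ∑ n, p n := by
  have h1 : p n ≤ ∑ n, p n := Finset.single_le_sum (fun n _ => hp n) (Finset.mem_univ n)
  have h2 := (hX n).2.1 t ht
  have h3 := hy.2.1 t ht
  have h4 : |X n t - y t| ≤ 1 := by rw [abs_le]; constructor <;> linarith
  rw [abs_mul, abs_of_nonneg (hp n)]
  nlinarith [hp n, abs_nonneg (X n t - y t)]

/-- The bound does not depend on the policy: it makes the supremum in `gap` meaningful and confines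
the gap vectors to a compact box. -/
lemma linearDecrease_le (h : IsSubgradient C G) (hT : 0 ≤ T) (hp : ∀ n, 0 ≤ p n)
    (hX : IsFeasible T a d s X) {n : Fin N} {y : ℝ → ℝ}
    (hy : y ∈ feasibleSet T (a n) (d n) (s n)) :
    linearDecrease G T p X n y ≤ T * (G (∑ n, p n) * ∑ n, p n) := by
  have hl := hX.isBoundedLoad hp
  rw [← setIntegral_Icc_const hT]
  refine setIntegral_mono_Icc
    (hl.integrableOn_comp_mul h.continuousOn_grad (hX.integrableOn_mul_sub hy))
    (integrableOn_const (by simp)) fun t ht => ?_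
  have h1 := hl.mem t ht
  have h2 := h.mono h1.1 h1.2
  have h3 := h.nonneg _ h1.1
  have h4 := (abs_le.1 (hX.abs_mul_sub_le hp hy ht)).2
  calc _ ≤ G (load p X t) * ∑ n, p n := mul_le_mul_of_nonneg_left h4 h3
    _ ≤ _ := mul_le_mul_of_nonneg_right h2 (Finset.sum_nonneg fun n _ => hp n)

lemma linearDecrease_self (n : Fin N) : linearDecrease G T p X n (X n) = 0 := by
  simp [linearDecrease]

lemma le_gap (h : IsSubgradient C G) (hT : 0 ≤ T) (hp : ∀ n, 0 ≤ p n)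
    (hX : IsFeasible T a d s X) {n : Fin N} {y : ℝ → ℝ}
    (hy : y ∈ feasibleSet T (a n) (d n) (s n)) :
    linearDecrease G T p X n y ≤ gap G T a d s p X n :=
  le_csSup ⟨_, Set.forall_mem_image.2 fun _ hz => linearDecrease_le h hT hp hX hz⟩
    (Set.mem_image_of_mem _ hy)

lemma gap_le (hX : IsFeasible T a d s X) {n : Fin N} {c : ℝ}
    (H : ∀ y ∈ feasibleSet T (a n) (d n) (s n), linearDecrease G T p X n y ≤ c) :
    gap G T a d s p X n ≤ c :=
  csSup_le ⟨_, Set.mem_image_of_mem _ (hX n)⟩ (Set.forall_mem_image.2 H)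

lemma gap_nonneg (h : IsSubgradient C G) (hT : 0 ≤ T) (hp : ∀ n, 0 ≤ p n)
    (hX : IsFeasible T a d s X) (n : Fin N) : 0 ≤ gap G T a d s p X n :=
  (linearDecrease_self n).symm.le.trans (le_gap h hT hp hX (hX n))

/-- The first order change of the cost splits into the contributions of the tasks. -/
lemma integral_grad_mul_load_sub (h : IsSubgradient C G) (hp : ∀ n, 0 ≤ p n)
    (hX : IsFeasible T a d s X) (hY : IsFeasible T a d s Y) :
    ∫ t in Set.Icc 0 T, G (load p X t) * (load p Y t - load p X t) =
      -∑ n, linearDecrease G T p X n (Y n) := by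
  have hl := hX.isBoundedLoad hp
  simp only [linearDecrease]
  rw [← integral_finsetSum _ fun n _ =>
    hl.integrableOn_comp_mul h.continuousOn_grad (hX.integrableOn_mul_sub (hY n)), ← integral_neg]
  congr 1 with t
  rw [← Finset.mul_sum, ← mul_neg]
  congr 1
  simp only [load, mul_sub, Finset.sum_sub_distrib]
  ring

/-- The linear term of the Bregman distance splits over the tasks, and unchanged tasks contribute
zero. It serves with `U` the full set (optimality bound), the recently updated tasks (persistence)
and a single task (minimality of one step). -/
lemma bregman_load_le (h : IsSubgradient C G) (hT : 0 ≤ T) (hp : ∀ n, 0 ≤ p n)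
    (hX : IsFeasible T a d s X) (hY : IsFeasible T a d s Y) (U : Finset (Fin N))
    (hU : ∀ n ∉ U, Y n = X n) :
    bregman C G T (load p Y) (load p X) ≤
      cost C T (load p Y) - cost C T (load p X) + ∑ n ∈ U, gap G T a d s p X n := by
  rw [h.bregman_eq hT (hY.isBoundedLoad hp) (hX.isBoundedLoad hp),
    integral_grad_mul_load_sub h hp hX hY, sub_neg_eq_add]
  gcongr
  rw [← Finset.sum_subset (Finset.subset_univ U)
    fun n _ hn => by rw [hU n hn, linearDecrease_self]]
  exact Finset.sum_le_sum fun n _ => le_gap h hT hp hX (hY n)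

lemma cost_sub_cost_le (h : IsSubgradient C G) (hT : 0 ≤ T) (hp : ∀ n, 0 ≤ p n)
    (hX : IsFeasible T a d s X) (hY : IsFeasible T a d s Y) :
    cost C T (load p X) - cost C T (load p Y) ≤ ∑ n, gap G T a d s p X n := by
  have h1 := bregman_load_le h hT hp hX hY Finset.univ (by simp)
  have h2 := h.bregman_nonneg (hY.isBoundedLoad hp) (hX.isBoundedLoad hp)
  linarith

/-- As task `n` has not moved, its linear decreases towards a common `y` at `X` and `Y` differ only
in the subgradient factor. -/
lemma gap_le_gap_add (h : IsSubgradient C G) (hT : 0 ≤ T) (hp : ∀ n, 0 ≤ p n)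
    (hX : IsFeasible T a d s X) (hY : IsFeasible T a d s Y) {n : Fin N} (hn : Y n = X n) :
    gap G T a d s p X n ≤ gap G T a d s p Y n +
      (∑ n, p n) * ∫ t in Set.Icc 0 T, |G (load p Y t) - G (load p X t)| := by
  refine gap_le hX fun y hy => ?_
  refine le_trans ?_ (add_le_add_left (le_gap h hT hp hY hy) _)
  have i1 := (hX.isBoundedLoad hp).integrableOn_comp_mul h.continuousOn_grad
    (hX.integrableOn_mul_sub (p := p) hy)
  have i2 := (hY.isBoundedLoad hp).integrableOn_comp_mul h.continuousOn_grad
    (hY.integrableOn_mul_sub (p := p) hy)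
  have i3 : IntegrableOn (fun t => (∑ n, p n) * |G (load p Y t) - G (load p X t)|)
      (Set.Icc 0 T) := (((hY.isBoundedLoad hp).integrableOn_comp h.continuousOn_grad).sub
    ((hX.isBoundedLoad hp).integrableOn_comp h.continuousOn_grad)).abs.const_mul (∑ n, p n)
  rw [linearDecrease, linearDecrease, ← integral_const_mul, ← integral_add i2 i3]
  refine setIntegral_mono_Icc i1 (i2.add i3) fun t ht => ?_
  have h1 := hX.abs_mul_sub_le hp hy ht
  simp only [hn]
  set g := G (load p Y t)
  set g' := G (load p X t)
  have h2 : (g' - g) * (p n * (X n t - y t)) ≤ |g - g'| * ∑ n, p n := by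
    rw [abs_sub_comm]
    refine (le_abs_self _).trans ?_
    rw [abs_mul]
    exact mul_le_mul_of_nonneg_left h1 (abs_nonneg _)
  linarith

lemma IsUpdate.cost_le {n : Fin N} {x : ℝ → ℝ} (hx : IsUpdate C T a d s p X n x)
    (hX : IsFeasible T a d s X) :
    cost C T (load p (Function.update X n x)) ≤ cost C T (load p X) := by
  simpa using hx.2 (X n) (hX n)

/-- Updating a task with a large gap decreases the cost by a definite amount. -/
lemma exists_decrease (h : IsSubgradient C G) (hT : 0 ≤ T) (hp : ∀ n, 0 ≤ p n)
    (hwin : ∀ n, 0 ≤ a n ∧ a n ≤ d n ∧ d n ≤ T) {ε : ℝ} (hε : 0 < ε) :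
    ∃ δ > 0, ∀ X, IsFeasible T a d s X → ∀ n x, IsUpdate C T a d s p X n x →
      ε ≤ gap G T a d s p X n →
        cost C T (load p (Function.update X n x)) + δ ≤ cost C T (load p X) := by
  have hP : 0 ≤ ∑ n, p n := Finset.sum_nonneg fun n _ => hp n
  set P := ∑ n, p n
  -- The competitor moves a fraction `τ` towards a `y` with linear decrease above `ε / 2`. The load
  -- then changes by less than `r`, and the choice of `η` limits the resulting loss in the linear
  -- decrease to `ε / 4`.
  obtain ⟨r, hr, H⟩ := h.exists_modulus P (η := ε / (4 * (T * P + 1))) (by positivity)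
  set τ := min 1 (r / (2 * (P + 1))) with hτ
  have hτ0 : 0 < τ := by positivity
  have hτP : τ * P < r := by
    have h1 : τ ≤ r / (2 * (P + 1)) := min_le_right _ _
    rw [le_div_iff₀ (by positivity)] at h1
    nlinarith
  refine ⟨τ * (ε / 4), by positivity, fun X hX n x hx hgap => ?_⟩
  obtain ⟨_, ⟨y, hy, rfl⟩, hlt⟩ := exists_lt_of_lt_csSup ⟨_, Set.mem_image_of_mem _ (hX n)⟩
    (show ε / 2 < sSup (linearDecrease G T p X n '' feasibleSet T (a n) (d n) (s n)) from
      lt_of_lt_of_le (by linarith) hgap)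
  have hz := lineMap_mem_feasibleSet (hwin n).1 (hwin n).2.1 (hwin n).2.2 (hX n) hy hτ0.le
    (min_le_left _ _)
  set z := fun t => (1 - τ) * X n t + τ * y t with hzdef
  have hZ := hX.update hz
  have hload : ∀ t, load p X t - load p (Function.update X n z) t =
      τ * (p n * (X n t - y t)) := fun t => by
    rw [load_update, hzdef]; ring
  have hbX := hX.isBoundedLoad hp
  have hbZ := hZ.isBoundedLoad hp
  -- The tangent is taken at the new policy, so convexity bounds the decrease of the cost from
  -- below.
  have hbr := h.bregman_nonneg hbX hbZ
  rw [h.bregman_eq hT hbX hbZ] at hbr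
  have hmin := hx.2 z hz
  have i0 := hX.integrableOn_mul_sub (p := p) hy
  have i1 := hbX.integrableOn_comp_mul h.continuousOn_grad i0
  have i2 := hbZ.integrableOn_comp_mul h.continuousOn_grad i0
  have ic : IntegrableOn (fun _ : ℝ => ε / (4 * (T * P + 1)) * P) (Set.Icc 0 T) :=
    integrableOn_const (by simp)
  have key := setIntegral_mono_Icc i1 (i2.add ic) fun t ht => by
    have hD := hX.abs_mul_sub_le hp hy ht
    have hclose : |load p X t - load p (Function.update X n z) t| < r := by
      rw [hload, abs_mul, abs_of_pos hτ0]
      exact (mul_le_mul_of_nonneg_left hD hτ0.le).trans_lt hτP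
    have hG := (H _ (hbX.mem t ht) _ (hbZ.mem t ht) hclose).le
    have h2 := le_abs_self ((G (load p X t) - G (load p (Function.update X n z) t)) *
      (p n * (X n t - y t)))
    rw [abs_mul] at h2
    have h3 := mul_le_mul hG hD (abs_nonneg _) (by positivity)
    simp only [Pi.add_apply]
    linarith
  have e := integral_add i2 ic
  simp only [Pi.add_apply] at key
  rw [e, setIntegral_Icc_const hT] at key
  have hsmall : T * (ε / (4 * (T * P + 1)) * P) ≤ ε / 4 := by
    have : T * (ε / (4 * (T * P + 1)) * P) = (T * P * ε) / (4 * (T * P + 1)) := by ring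
    rw [this, div_le_div_iff₀ (by positivity) (by positivity)]
    nlinarith [mul_nonneg hT hP]
  have hint : ∫ t in Set.Icc 0 T, G (load p (Function.update X n z) t) *
      (load p X t - load p (Function.update X n z) t) =
      τ * ∫ t in Set.Icc 0 T, G (load p (Function.update X n z) t) * (p n * (X n t - y t)) := by
    rw [← integral_const_mul]
    congr 1 with t
    rw [hload]; ring
  rw [hint] at hbr
  rw [linearDecrease] at hlt
  have : τ * (ε / 4) ≤ τ * ∫ t in Set.Icc 0 T, G (load p (Function.update X n z) t) *
      (p n * (X n t - y t)) := mul_le_mul_of_nonneg_left (by linarith) hτ0.le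
  linarith

lemma IsUpdate.gap_eq_zero (h : IsSubgradient C G) (hT : 0 ≤ T) (hp : ∀ n, 0 ≤ p n)
    (hwin : ∀ n, 0 ≤ a n ∧ a n ≤ d n ∧ d n ≤ T) (hX : IsFeasible T a d s X) {n : Fin N}
    (hx : IsUpdate C T a d s p X n (X n)) : gap G T a d s p X n = 0 := by
  refine le_antisymm ?_ (gap_nonneg h hT hp hX n)
  by_contra! hlt
  obtain ⟨δ, hδ, H⟩ := exists_decrease (s := s) h hT hp hwin hlt
  have := H X hX n _ hx le_rfl
  rw [Function.update_eq_self] at this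
  linarith

end Gap

/-! ### Convergence along runs. -/

section Run

variable {N : ℕ} {T : ℝ} {a d s p : Fin N → ℝ} {C G : ℝ → ℝ} {i : ℕ → Fin N}
  {X : ℕ → Fin N → ℝ → ℝ}

lemma IsRun.isFeasible (hX : IsRun C T a d s p i X) (k : ℕ) : IsFeasible T a d s (X k) := by
  induction k with
  | zero => exact hX.1
  | succ k ih =>
    obtain ⟨x, hx, hk⟩ := hX.2 k
    rw [hk]
    exact ih.update hx.1

lemma IsRun.antitone_cost (hX : IsRun C T a d s p i X) :
    Antitone fun k => cost C T (load p (X k)) :=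
  antitone_nat_of_succ_le fun k => by
    obtain ⟨x, hx, hk⟩ := hX.2 k
    rw [hk]
    exact hx.cost_le (hX.isFeasible k)

lemma IsRun.apply_eq_of_forall_ne (hX : IsRun C T a d s p i X) {n : Fin N} {k m : ℕ} (hkm : k ≤ m)
    (h : ∀ j, k ≤ j → j < m → i j ≠ n) : X m n = X k n := by
  induction m, hkm using Nat.le_induction with
  | base => rfl
  | succ m hkm ih =>
    obtain ⟨x, -, hk⟩ := hX.2 m
    rw [hk, Function.update_of_ne (h m hkm (Nat.lt_succ_self m)).symm]
    exact ih fun j h1 h2 => h j h1 (h2.trans (Nat.lt_succ_self m))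

/-- The total gap becomes arbitrarily small along a run that visits every task infinitely often. -/
lemma IsRun.exists_sum_gap_lt (h : IsSubgradient C G) (hT : 0 ≤ T) (hp : ∀ n, 0 ≤ p n)
    (hwin : ∀ n, 0 ≤ a n ∧ a n ≤ d n ∧ d n ≤ T) (hi : ∀ n, ∃ᶠ k in atTop, i k = n)
    (hX : IsRun C T a d s p i X) {Y : Fin N → ℝ → ℝ} (hY : IsOptimal C T a d s p Y) :
    ∀ ε > 0, ∃ k, ∑ n, gap G T a d s p (X k) n < ε := by
  have hf := hX.isFeasible
  have hP : 0 ≤ ∑ n, p n := Finset.sum_nonneg fun n _ => hp n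
  refine LoadBalancing.exists_sum_gap_lt (fun k => cost C T (load p (X k)))
    (fun k n => gap G T a d s p (X k) n) i (T * (G (∑ n, p n) * ∑ n, p n)) hi hX.antitone_cost
    ⟨cost C T (load p Y), Set.forall_mem_range.2 fun k => hY.2 _ (hf k)⟩
    (fun k n => ⟨gap_nonneg h hT hp (hf k) n,
      gap_le (hf k) fun y hy => linearDecrease_le h hT hp (hf k) hy⟩) ?_ ?_
  · intro ε hε
    obtain ⟨δ, hδ, H⟩ := exists_decrease (s := s) h hT hp hwin hε
    refine ⟨δ, hδ, fun k hk => ?_⟩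
    obtain ⟨x, hx, hk'⟩ := hX.2 k
    have := H (X k) (hf k) (i k) x hx hk
    rw [← hk'] at this
    linarith
  · intro ε hε
    set P := ∑ n, p n
    obtain ⟨δ, hδ, H⟩ := h.integral_abs_sub_le hT P (ε := ε / (P + 1)) (by positivity)
    refine ⟨δ, hδ, fun U k m hkm hU hsum n hn => ?_⟩
    have heq : ∀ n ∉ U, X m n = X k n := fun n hn =>
      hX.apply_eq_of_forall_ne hkm fun j h1 h2 hj => hn (hj ▸ hU j h1 h2)
    have hb := bregman_load_le h hT hp (hf k) (hf m) U heq
    -- With this the cost difference drops out of `hb`, and the gaps in `U` alone bound the Bregman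
    -- distance.
    have hc : cost C T (load p (X m)) ≤ cost C T (load p (X k)) := hX.antitone_cost hkm
    have h1 := H _ _ ((hf m).isBoundedLoad hp) ((hf k).isBoundedLoad hp) (by linarith)
    have h2 := gap_le_gap_add h hT hp (hf k) (hf m) (heq n hn)
    have h3 := mul_le_mul_of_nonneg_left h1 hP
    have h4 : P * (ε / (P + 1)) ≤ ε := by
      rw [mul_div_assoc', div_le_iff₀ (by positivity)]
      nlinarith
    linarith

lemma IsRun.tendsto_cost (h : IsSubgradient C G) (hT : 0 ≤ T) (hp : ∀ n, 0 ≤ p n)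
    (hwin : ∀ n, 0 ≤ a n ∧ a n ≤ d n ∧ d n ≤ T) (hi : ∀ n, ∃ᶠ k in atTop, i k = n)
    (hX : IsRun C T a d s p i X) {Y : Fin N → ℝ → ℝ} (hY : IsOptimal C T a d s p Y) :
    Tendsto (fun k => cost C T (load p (X k))) atTop (𝓝 (cost C T (load p Y))) := by
  refine tendsto_order.2 ⟨fun c hc => Eventually.of_forall fun k =>
    hc.trans_le (hY.2 _ (hX.isFeasible k)), fun c hc => ?_⟩
  obtain ⟨k, hk⟩ := hX.exists_sum_gap_lt h hT hp hwin hi hY (c - cost C T (load p Y)) (by linarith)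
  filter_upwards [eventually_ge_atTop k] with m hm
  have h1 := cost_sub_cost_le h hT hp (hX.isFeasible k) hY.1
  have h2 : cost C T (load p (X m)) ≤ cost C T (load p (X k)) := hX.antitone_cost hm
  linarith

/-- For a strictly convex cost, nearly optimal policies have loads close to the optimal one. -/
lemma exists_integral_abs_load_sub_le (hcont : ContinuousOn C (Set.Ici 0))
    (hC : StrictConvexOn ℝ (Set.Ici 0) C) (hT : 0 ≤ T) (hp : ∀ n, 0 ≤ p n)
    (hwin : ∀ n, 0 ≤ a n ∧ a n ≤ d n ∧ d n ≤ T) {ε : ℝ} (hε : 0 < ε) :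
    ∃ K, 0 ≤ K ∧ ∀ X Y, IsFeasible T a d s X → IsFeasible T a d s Y →
      cost C T (load p Y) ≤ cost C T (load p fun n t => (1 - 1 / 2) * X n t + 1 / 2 * Y n t) →
      ∫ t in Set.Icc 0 T, |load p X t - load p Y t| ≤
        ε + K * (cost C T (load p X) - cost C T (load p Y)) := by
  obtain ⟨K, hK, H⟩ := abs_sub_le_of_strictConvexOn hC hcont (∑ n, p n)
    (η := ε / (T + 1)) (by positivity)
  -- Since `Y` is no worse than the midpoint policy, the integrated midpoint deficit is at most half
  -- the cost difference.
  refine ⟨K / 2, by positivity, fun X Y hX hY hmin => ?_⟩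
  set Z : Fin N → ℝ → ℝ := fun n t => (1 - 1 / 2) * X n t + 1 / 2 * Y n t with hZdef
  have hZ : IsFeasible T a d s Z := fun n =>
    lineMap_mem_feasibleSet (hwin n).1 (hwin n).2.1 (hwin n).2.2 (hX n) (hY n) (by norm_num)
      (by norm_num)
  have hload : ∀ t, load p Z t = (load p X t + load p Y t) / 2 := fun t => by
    simp only [load, hZdef, ← Finset.sum_add_distrib, Finset.sum_div]
    exact Finset.sum_congr rfl fun n _ => by ring
  have hbX := hX.isBoundedLoad hp
  have hbY := hY.isBoundedLoad hp
  have hbZ := hZ.isBoundedLoad hp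
  have iX := hbX.integrableOn_comp hcont
  have iY := hbY.integrableOn_comp hcont
  have iZ := hbZ.integrableOn_comp hcont
  have iM : IntegrableOn (fun t => (C (load p X t) + C (load p Y t)) / 2 - C (load p Z t))
    (Set.Icc 0 T) := ((iX.add iY).div_const 2).sub iZ
  have ic : IntegrableOn (fun _ : ℝ => ε / (T + 1)) (Set.Icc 0 T) :=
    integrableOn_const (by simp)
  have key := setIntegral_mono_Icc (hbX.integrableOn.sub hbY.integrableOn).abs
    (ic.add (iM.const_mul K)) fun t ht => by
      have := H _ (hbX.mem t ht) _ (hbY.mem t ht)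
      rw [← hload] at this
      exact this
  have e := integral_add ic (iM.const_mul K)
  have e2 : ∫ t in Set.Icc 0 T, ((C (load p X t) + C (load p Y t)) / 2 - C (load p Z t)) =
      (cost C T (load p X) + cost C T (load p Y)) / 2 - cost C T (load p Z) := by
    rw [cost_eq hT, cost_eq hT, cost_eq hT, ← integral_add iX iY, ← integral_div]
    exact integral_sub ((iX.add iY).div_const 2) iZ
  simp only [Pi.add_apply] at key
  rw [e, setIntegral_Icc_const hT, integral_const_mul, e2] at key
  have h1 : T * (ε / (T + 1)) ≤ ε := by
    rw [mul_div_assoc', div_le_iff₀ (by positivity)]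
    nlinarith
  have h2 := mul_le_mul_of_nonneg_left hmin hK
  simp only [Pi.sub_apply] at key
  linarith

lemma IsRun.loadsTendsto (h : IsSubgradient C G) (hC : StrictConvexOn ℝ (Set.Ici 0) C)
    (hT : 0 ≤ T) (hp : ∀ n, 0 ≤ p n)
    (hwin : ∀ n, 0 ≤ a n ∧ a n ≤ d n ∧ d n ≤ T) (hi : ∀ n, ∃ᶠ k in atTop, i k = n)
    (hX : IsRun C T a d s p i X) {Y : Fin N → ℝ → ℝ} (hY : IsOptimal C T a d s p Y) :
    LoadsTendsto T (fun k => load p (X k)) (load p Y) := by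
  have hcost := hX.tendsto_cost h hT hp hwin hi hY
  have hint : ∀ k, ∫ t in (0 : ℝ)..T, |load p (X k) t - load p Y t| =
      ∫ t in Set.Icc 0 T, |load p (X k) t - load p Y t| := fun k => by
    rw [intervalIntegral.integral_of_le hT, integral_Icc_eq_integral_Ioc]
  simp only [LoadsTendsto, hint]
  refine tendsto_order.2 ⟨fun c hc => Eventually.of_forall fun k =>
    hc.trans_le (integral_nonneg fun t => abs_nonneg _), fun c hc => ?_⟩
  obtain ⟨K, hK, H⟩ := exists_integral_abs_load_sub_le (s := s) h.continuousOn hC hT hp hwin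
    (half_pos hc)
  have hlim : Tendsto (fun k => c / 2 + K * (cost C T (load p (X k)) - cost C T (load p Y))) atTop
      (𝓝 (c / 2 + K * (cost C T (load p Y) - cost C T (load p Y)))) :=
    ((hcost.sub_const _).const_mul K).const_add _
  rw [sub_self, mul_zero, add_zero] at hlim
  filter_upwards [hlim.eventually_lt_const (half_lt_self hc)] with k hk
  refine (H (X k) Y (hX.isFeasible k) hY.1 (hY.2 _ fun n => ?_)).trans_lt hk
  exact lineMap_mem_feasibleSet (hwin n).1 (hwin n).2.1 (hwin n).2.2 (hX.isFeasible k n) (hY.1 n)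
    (by norm_num) (by norm_num)

end Run

/-! ### Water filling and the reduction to the quadratic cost. -/

/-- Water filling: some admissible activity function levels `q + p x` at a height `c`. -/
lemma exists_level {T a d s p P : ℝ} {q : ℝ → ℝ} (ha : 0 ≤ a) (had : a ≤ d) (hd : d ≤ T)
    (hs0 : 0 ≤ s) (hs : s ≤ d - a) (hp : 0 < p) (hq : IsBoundedLoad T P q) :
    ∃ x ∈ feasibleSet T a d s, ∃ c, 0 ≤ c ∧ (∀ t ∉ Set.Icc a d, x t = 0) ∧
      ∀ t ∈ Set.Icc a d, (q t + p * x t ≤ c ∨ x t = 0) ∧ (c ≤ q t + p * x t ∨ x t = 1) := by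
  have hsub : Set.Icc a d ⊆ Set.Icc 0 T := Set.Icc_subset_Icc ha hd
  -- `f c` fills up to height `c`, clipped to `[0, 1]`. Its integral over the window is continuous
  -- in `c`, zero at `0` and `d - a` at `P + p`, so some height gives `s`.
  set f : ℝ → ℝ → ℝ := fun c t => max 0 (min 1 ((c - q t) / p)) with hf
  have hf01 : ∀ c t, 0 ≤ f c t ∧ f c t ≤ 1 := fun c t =>
    ⟨le_max_left _ _, max_le zero_le_one (min_le_left _ _)⟩
  have hmeas : ∀ c, AEMeasurable (f c) (volume.restrict (Set.Icc 0 T)) := fun c =>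
    aemeasurable_const.max (aemeasurable_const.min
      ((aemeasurable_const.sub hq.aemeasurable).div_const p))
  have hmeas' : ∀ c, AEMeasurable (f c) (volume.restrict (Set.Icc a d)) := fun c =>
    (hmeas c).mono_set hsub
  have hcont : Continuous fun c => ∫ t in Set.Icc a d, f c t := by
    refine continuous_of_dominated (bound := fun _ => 1)
      (fun c => (hmeas' c).aestronglyMeasurable) (fun c => Eventually.of_forall fun t => ?_)
      (integrable_const 1) (Eventually.of_forall fun t => by fun_prop)
    rw [Real.norm_eq_abs, abs_of_nonneg (hf01 c t).1]
    exact (hf01 c t).2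
  have hP : 0 ≤ P := by
    have := hq.mem a (hsub (Set.left_mem_Icc.2 had))
    exact this.1.trans this.2
  have h0 : ∫ t in Set.Icc a d, f 0 t = 0 := by
    refine setIntegral_eq_zero_of_forall_eq_zero fun t ht => max_eq_left ?_
    refine (min_le_right _ _).trans (div_nonpos_of_nonpos_of_nonneg ?_ hp.le)
    linarith [(hq.mem t (hsub ht)).1]
  have h1 : ∫ t in Set.Icc a d, f (P + p) t = d - a := by
    have : ∀ t ∈ Set.Icc a d, f (P + p) t = 1 := fun t ht => by
      have h : 1 ≤ (P + p - q t) / p := by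
        rw [le_div_iff₀ hp]
        linarith [(hq.mem t (hsub ht)).2]
      simp [hf, min_eq_left h]
    rw [setIntegral_congr_fun measurableSet_Icc this]
    simp [had]
  obtain ⟨c, hc, hcs⟩ := intermediate_value_Icc (show 0 ≤ P + p by linarith) hcont.continuousOn
    (show s ∈ Set.Icc _ _ by simp only [h0, h1]; exact ⟨hs0, hs⟩)
  refine ⟨(Set.Icc a d).indicator (f c), ?_, c, hc.1,
    fun t ht => Set.indicator_of_notMem ht _, fun t ht => ?_⟩
  · refine mem_feasibleSet_of_setIntegral had ((hmeas c).indicator measurableSet_Icc) ?_ ?_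
    · intro t _
      by_cases ht : t ∈ Set.Icc a d
      · rw [Set.indicator_of_mem ht]; exact hf01 c t
      · rw [Set.indicator_of_notMem ht]; simp
    · rw [setIntegral_congr_fun measurableSet_Icc
        (fun t ht => Set.indicator_of_mem ht (f c))]
      exact hcs
  · rw [Set.indicator_of_mem ht]
    constructor
    · rcases le_total ((c - q t) / p) 0 with h | h
      · right
        simp only [hf]
        exact max_eq_left ((min_le_right _ _).trans h)
      · left
        have : f c t ≤ (c - q t) / p := max_le h (min_le_right _ _)
        rw [le_div_iff₀ hp] at this
        linarith
    · rcases le_total ((c - q t) / p) 1 with h | h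
      · left
        have : (c - q t) / p ≤ f c t := by
          simp only [hf, min_eq_right h]; exact le_max_right _ _
        rw [div_le_iff₀ hp] at this
        linarith
      · right
        simp [hf, min_eq_left h]

section Update

variable {N : ℕ} {T : ℝ} {a d s p : Fin N → ℝ} {C G : ℝ → ℝ} {X : Fin N → ℝ → ℝ}

lemma isUpdate_of_linearDecrease_nonpos (h : IsSubgradient C G) (hT : 0 ≤ T) (hp : ∀ n, 0 ≤ p n)
    (hX : IsFeasible T a d s X) {n : Fin N}
    (H : ∀ y ∈ feasibleSet T (a n) (d n) (s n), linearDecrease G T p X n y ≤ 0) :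
    IsUpdate C T a d s p X n (X n) := by
  refine ⟨hX n, fun y hy => ?_⟩
  have hY := hX.update hy
  have h1 := bregman_load_le h hT hp hX hY {n} fun j hj => by
    rw [Finset.mem_singleton] at hj
    simp [hj]
  have h2 := h.bregman_nonneg (hY.isBoundedLoad hp) (hX.isBoundedLoad hp)
  have h3 := gap_le hX H
  rw [Finset.sum_singleton] at h1
  rw [Function.update_eq_self]
  linarith

/-- A step forgets the old activity of its task, so minimality can be tested at the updated policy.
-/
lemma isUpdate_update_iff {n : Fin N} {x y : ℝ → ℝ} :
    IsUpdate C T a d s p (Function.update X n y) n x ↔ IsUpdate C T a d s p X n x := by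
  simp [IsUpdate]

/-- A single activity function minimizes a step of the algorithm for all cost functions. -/
lemma exists_common_update (hT : 0 ≤ T) (hp : ∀ n, 0 ≤ p n)
    (hwin : ∀ n, 0 ≤ a n ∧ a n ≤ d n ∧ d n ≤ T) (hs : ∀ n, 0 ≤ s n ∧ s n ≤ d n - a n)
    (hX : IsFeasible T a d s X) (n : Fin N) :
    ∃ x, ∀ C G, IsSubgradient C G → IsUpdate C T a d s p X n x := by
  -- With zero power the load ignores the activity, so the current one is a minimizer.
  rcases (hp n).eq_or_lt with hpn | hpn
  · refine ⟨X n, fun C G _ => ⟨hX n, fun y hy => le_of_eq ?_⟩⟩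
    congr 1 with t
    simp [load_update, ← hpn]
  have hsub : Set.Icc (a n) (d n) ⊆ Set.Icc 0 T := Set.Icc_subset_Icc (hwin n).1 (hwin n).2.2
  have hbX := hX.isBoundedLoad hp
  have hq : IsBoundedLoad T (∑ n, p n) fun t => load p X t - p n * X n t := by
    refine ⟨hbX.aemeasurable.sub ((hX n).1.const_mul _), fun t ht => ⟨?_, ?_⟩⟩
    · have := Finset.single_le_sum (f := fun n => p n * X n t)
        (fun n _ => mul_nonneg (hp n) ((hX n).2.1 t ht).1) (Finset.mem_univ n)
      simp only [load]
      linarith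
    · have := mul_nonneg (hp n) ((hX n).2.1 t ht).1
      linarith [(hbX.mem t ht).2]
  obtain ⟨x, hx, c, hc, hout, hin⟩ := exists_level (hwin n).1 (hwin n).2.1 (hwin n).2.2 (hs n).1
    (hs n).2 hpn hq
  refine ⟨x, fun C G h => ?_⟩
  have hZ := hX.update hx
  have hbZ := hZ.isBoundedLoad hp
  rw [← isUpdate_update_iff (y := x)]
  have hxn : Function.update X n x n = x := Function.update_self n x X
  suffices H : ∀ y ∈ feasibleSet T (a n) (d n) (s n),
      linearDecrease G T p (Function.update X n x) n y ≤ 0 by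
    simpa only [hxn] using isUpdate_of_linearDecrease_nonpos h hT hp hZ H
  intro y hy
  have hint : IntegrableOn (fun t => G c * (p n * (x t - y t))) (Set.Icc 0 T) := by
    have := (hZ.integrableOn_mul_sub (p := p) hy).const_mul (G c)
    rwa [hxn] at this
  -- Inside the window `G` of the load is replaced by the constant `G c`, whose integral against `x
  -- - y` vanishes because both activities have integral `s`. The replacement uses only the
  -- monotonicity of `G` and the level property, so `x` is independent of the cost.
  have hzero : ∫ t in Set.Icc 0 T,
      (Set.Icc (a n) (d n)).indicator (fun t => G c * (p n * (x t - y t))) t = 0 := by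
    rw [setIntegral_indicator measurableSet_Icc, Set.inter_eq_self_of_subset_right hsub,
      integral_const_mul, integral_const_mul,
      integral_sub ((integrableOn_of_mem_feasibleSet hx).mono_set hsub)
        ((integrableOn_of_mem_feasibleSet hy).mono_set hsub),
      integral_eq_setIntegral_of_mem_feasibleSet (hwin n).2.1 hx,
      integral_eq_setIntegral_of_mem_feasibleSet (hwin n).2.1 hy]
    ring
  rw [← hzero]
  refine setIntegral_mono_Icc
    (hbZ.integrableOn_comp_mul h.continuousOn_grad (hZ.integrableOn_mul_sub hy))
    (hint.indicator measurableSet_Icc) fun t ht => ?_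
  have hy01 := hy.2.1 t ht
  have hx01 := hx.2.1 t ht
  have hl0 := (hbZ.mem t ht).1
  have hl : load p (Function.update X n x) t = load p X t - p n * X n t + p n * x t := by
    rw [load_update]; ring
  rw [hxn]
  by_cases htw : t ∈ Set.Icc (a n) (d n)
  · rw [Set.indicator_of_mem htw]
    obtain ⟨h1, h2⟩ := hin t htw
    rw [← hl] at h1 h2
    have hpos : G (load p (Function.update X n x) t) * (x t - y t) ≤ G c * (x t - y t) := by
      rcases le_total (y t) (x t) with hyx | hyx
      · rcases h1 with h1 | h1
        · exact mul_le_mul_of_nonneg_right (h.mono hl0 h1) (by linarith)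
        · have : x t - y t = 0 := by linarith
          simp [this]
      · rcases h2 with h2 | h2
        · exact mul_le_mul_of_nonpos_right (h.mono hc h2) (by linarith)
        · have : x t - y t = 0 := by linarith
          simp [this]
    nlinarith [mul_le_mul_of_nonneg_left hpos hpn.le]
  -- Outside the window `x` vanishes, which is best because `G` is nonnegative.
  · rw [Set.indicator_of_notMem htw, hout t htw]
    have := mul_nonneg (h.nonneg _ hl0) (mul_nonneg hpn.le hy01.1)
    linarith

lemma exists_isBalancedUpdate (h : IsSubgradient C G) (hT : 0 ≤ T) (hp : ∀ n, 0 ≤ p n)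
    (hwin : ∀ n, 0 ≤ a n ∧ a n ≤ d n ∧ d n ≤ T) (hs : ∀ n, 0 ≤ s n ∧ s n ≤ d n - a n)
    (hX : IsFeasible T a d s X) (n : Fin N) : ∃ x, IsBalancedUpdate C T a d s p X n x := by
  obtain ⟨x, hx⟩ := exists_common_update hT hp hwin hs hX n
  exact ⟨x, hx C G h, fun y hy => (hx _ _ isSubgradient_sq).2 y hy.1⟩

/-- The common minimizer belongs to the argmin for `C`, so the most balanced one has no larger
quadratic cost, and that cost is already the minimum over all admissible activities. -/
lemma IsBalancedUpdate.isUpdate_sq (h : IsSubgradient C G) (hT : 0 ≤ T) (hp : ∀ n, 0 ≤ p n)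
    (hwin : ∀ n, 0 ≤ a n ∧ a n ≤ d n ∧ d n ≤ T) (hs : ∀ n, 0 ≤ s n ∧ s n ≤ d n - a n)
    (hX : IsFeasible T a d s X) {n : Fin N} {x : ℝ → ℝ}
    (hx : IsBalancedUpdate C T a d s p X n x) : IsUpdate (fun u => u ^ 2) T a d s p X n x := by
  obtain ⟨w, hw⟩ := exists_common_update hT hp hwin hs hX n
  exact ⟨hx.1.1, fun y hy => (hx.2 w (hw C G h)).trans ((hw _ _ isSubgradient_sq).2 y hy)⟩

lemma IsBalancedRun.isRun_sq (h : IsSubgradient C G) (hT : 0 ≤ T) (hp : ∀ n, 0 ≤ p n)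
    (hwin : ∀ n, 0 ≤ a n ∧ a n ≤ d n ∧ d n ≤ T) (hs : ∀ n, 0 ≤ s n ∧ s n ≤ d n - a n)
    {i : ℕ → Fin N} {X : ℕ → Fin N → ℝ → ℝ} (hX : IsBalancedRun C T a d s p i X) :
    IsRun (fun u => u ^ 2) T a d s p i X := by
  have hrun : IsRun C T a d s p i X := ⟨hX.1, fun k => (hX.2 k).imp fun x hx => ⟨hx.1.1, hx.2⟩⟩
  exact ⟨hX.1, fun k => (hX.2 k).imp fun x hx =>
    ⟨hx.1.isUpdate_sq h hT hp hwin hs (hrun.isFeasible k), hx.2⟩⟩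

/-- A policy optimal for the quadratic cost is optimal for every cost. -/
lemma IsOptimal.of_sq (h : IsSubgradient C G) (hT : 0 ≤ T) (hp : ∀ n, 0 ≤ p n)
    (hwin : ∀ n, 0 ≤ a n ∧ a n ≤ d n ∧ d n ≤ T) (hs : ∀ n, 0 ≤ s n ∧ s n ≤ d n - a n)
    (hX : IsOptimal (fun u => u ^ 2) T a d s p X) : IsOptimal C T a d s p X := by
  have hf := hX.1
  suffices hgap : ∀ n, gap G T a d s p X n ≤ 0 by
    refine ⟨hf, fun Y hY => ?_⟩
    have h1 := cost_sub_cost_le h hT hp hf hY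
    have h2 := Finset.sum_nonpos fun n (_ : n ∈ Finset.univ) => hgap n
    linarith
  intro n
  -- Passing to `w` does not raise the quadratic cost, so by strict convexity it leaves the load
  -- unchanged almost everywhere. The gap for `C` vanishes after this update, and it sees only the
  -- load and `p n` times the activity, hence it vanishes at `X`.
  obtain ⟨w, hw⟩ := exists_common_update hT hp hwin hs hf n
  have hwf := (hw C G h).1
  have hW := hf.update hwf
  have hbX := hf.isBoundedLoad hp
  have hbW := hW.isBoundedLoad hp
  have hcost : cost (fun u => u ^ 2) T (load p (Function.update X n w)) ≤
      cost (fun u => u ^ 2) T (load p X) := (hw _ _ isSubgradient_sq).cost_le hf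
  have hint : ∫ t in Set.Icc 0 T, |load p (Function.update X n w) t - load p X t| = 0 := by
    refine le_antisymm (le_of_forall_pos_le_add fun ε hε => ?_)
      (integral_nonneg fun t => abs_nonneg _)
    obtain ⟨K, hK, H⟩ := exists_integral_abs_load_sub_le (s := s) isSubgradient_sq.continuousOn
      strictConvexOn_sq hT hp hwin hε
    refine (H _ X hW hf (hX.2 _ fun j => ?_)).trans ?_
    · exact lineMap_mem_feasibleSet (hwin j).1 (hwin j).2.1 (hwin j).2.2 (hW j) (hf j)
        (by norm_num) (by norm_num)
    · nlinarith
  have hae : ∀ᵐ t ∂volume.restrict (Set.Icc 0 T),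
      load p (Function.update X n w) t = load p X t := by
    have := (integral_eq_zero_iff_of_nonneg (fun t => abs_nonneg _)
      (hbW.integrableOn.sub hbX.integrableOn).abs).1 hint
    filter_upwards [this] with t ht
    simpa [sub_eq_zero] using ht
  have hup : IsUpdate C T a d s p (Function.update X n w) n (Function.update X n w n) := by
    rw [isUpdate_update_iff, Function.update_self]
    exact hw C G h
  refine gap_le hf fun y hy => ?_
  have hle := le_gap h hT hp hW hy
  rw [hup.gap_eq_zero h hT hp hwin hW] at hle
  refine le_of_eq_of_le (integral_congr_ae ?_) hle
  filter_upwards [hae] with t ht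
  have hpx : p n * (w t - X n t) = 0 := by
    rw [load_update] at ht; linarith
  rw [ht, Function.update_self]
  congr 1
  linarith

end Update

/-! ### Existence of a quadratic optimum by projection in a Hilbert space. -/

/-- A decreasing sequence of nonempty bounded closed convex sets in a Hilbert space has a common
point. -/
lemma nonempty_iInter_of_antitone_convex {H : Type*} [NormedAddCommGroup H]
    [InnerProductSpace ℝ H] [CompleteSpace H] {K : ℕ → Set H} (hK : Antitone K)
    (hclosed : ∀ k, IsClosed (K k)) (hconv : ∀ k, Convex ℝ (K k)) (hne : ∀ k, (K k).Nonempty)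
    {R : ℝ} (hR : ∀ u ∈ K 0, ‖u‖ ≤ R) : (⋂ k, K k).Nonempty := by
  have hmin : ∀ k, ∃ v ∈ K k, ∀ w ∈ K k, ‖v‖ ≤ ‖w‖ := fun k => by
    obtain ⟨v, hv, h⟩ :=
      exists_norm_eq_iInf_of_complete_convex (hne k) (hclosed k).isComplete (hconv k) 0
    refine ⟨v, hv, fun w hw => ?_⟩
    simp only [zero_sub, norm_neg] at h
    rw [h]
    exact ciInf_le (f := fun w : K k => ‖(w : H)‖)
      ⟨0, Set.forall_mem_range.2 fun _ => norm_nonneg _⟩ ⟨w, hw⟩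
  choose v hv hvmin using hmin
  have hmono : Monotone fun k => ‖v k‖ ^ 2 := fun j k hjk =>
    pow_le_pow_left₀ (norm_nonneg _) (hvmin j _ (hK hjk (hv k))) 2
  have hbdd : BddAbove (Set.range fun k => ‖v k‖ ^ 2) :=
    ⟨R ^ 2, Set.forall_mem_range.2 fun k =>
      pow_le_pow_left₀ (norm_nonneg _) (hR _ (hK (Nat.zero_le k) (hv k))) 2⟩
  have hlim := tendsto_atTop_ciSup hmono hbdd
  -- For `k ≥ n` the midpoint of `v k` and `v n` lies in `K n`, so the parallelogram law bounds `‖v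
  -- k - v n‖ ^ 2` by `2 * (‖v k‖ ^ 2 - ‖v n‖ ^ 2)`.
  have hcauchy : CauchySeq v := by
    rw [Metric.cauchySeq_iff']
    intro ε hε
    obtain ⟨n, hn⟩ := Metric.cauchySeq_iff'.1 hlim.cauchySeq (ε ^ 2 / 2) (by positivity)
    refine ⟨n, fun k hk => ?_⟩
    have hmid : (1 / 2 : ℝ) • v k + (1 / 2 : ℝ) • v n ∈ K n :=
      hconv n (hK hk (hv k)) (hv n) (by norm_num) (by norm_num) (by norm_num)
    have h1 := hvmin n _ hmid
    rw [← smul_add, norm_smul, Real.norm_of_nonneg (by norm_num : (0 : ℝ) ≤ 1 / 2)] at h1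
    have h2 := parallelogram_law_with_norm ℝ (v k) (v n)
    have h3 := (abs_lt.1 (hn k hk)).2
    have h4 : ‖v n‖ ^ 2 ≤ (1 / 2 * ‖v k + v n‖) ^ 2 := pow_le_pow_left₀ (norm_nonneg _) h1 2
    rw [dist_eq_norm]
    refine lt_of_pow_lt_pow_left₀ 2 hε.le ?_
    nlinarith
  obtain ⟨u, hu⟩ := cauchySeq_tendsto_of_complete hcauchy
  refine ⟨u, Set.mem_iInter.2 fun k => (hclosed k).mem_of_tendsto hu ?_⟩
  filter_upwards [eventually_ge_atTop k] with j hj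
  exact hK hj (hv j)

/-- The norm of a continuous linear map attains its minimum on a nonempty bounded closed convex
subset of a Hilbert space. -/
lemma exists_norm_map_le {H E : Type*} [NormedAddCommGroup H] [InnerProductSpace ℝ H]
    [CompleteSpace H] [NormedAddCommGroup E] [NormedSpace ℝ E] (L : H →L[ℝ] E) {K : Set H}
    (hclosed : IsClosed K) (hconv : Convex ℝ K) (hne : K.Nonempty) {R : ℝ}
    (hR : ∀ u ∈ K, ‖u‖ ≤ R) : ∃ u ∈ K, ∀ v ∈ K, ‖L u‖ ≤ ‖L v‖ := by
  set m := sInf ((fun u => ‖L u‖) '' K)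
  have hm : ∀ v ∈ K, m ≤ ‖L v‖ := fun v hv =>
    csInf_le ⟨0, Set.forall_mem_image.2 fun _ _ => norm_nonneg _⟩ (Set.mem_image_of_mem _ hv)
  -- A common point of the sublevel sets at heights decreasing to the infimum is a minimizer; this
  -- takes the place of weak compactness.
  obtain ⟨u, hu⟩ := nonempty_iInter_of_antitone_convex
    (K := fun k : ℕ => K ∩ {u | ‖L u‖ ≤ m + 1 / ((k : ℝ) + 1)})
    (fun j k hjk u hu => ⟨hu.1, le_trans hu.2 (add_le_add_right (Nat.one_div_le_one_div hjk) m)⟩)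
    (fun k => hclosed.inter (isClosed_le (by fun_prop) continuous_const))
    (fun k => hconv.inter (by
      have := (convexOn_norm (convex_univ (𝕜 := ℝ) (E := E))).comp_linearMap (L : H →ₗ[ℝ] E)
      simpa using this.convex_le (m + 1 / ((k : ℝ) + 1))))
    (fun k => by
      obtain ⟨_, ⟨u, hu, rfl⟩, hlt⟩ := exists_lt_of_csInf_lt (hne.image fun u => ‖L u‖)
        (show m < m + 1 / ((k : ℝ) + 1) by
          have : (0 : ℝ) < 1 / ((k : ℝ) + 1) := by positivity
          linarith)
      exact ⟨u, hu, hlt.le⟩)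
    (R := R) (fun u hu => hR u hu.1)
  have hu' := fun k => Set.mem_iInter.1 hu k
  refine ⟨u, (hu' 0).1, fun v hv => le_trans ?_ (hm v hv)⟩
  have hlim : Tendsto (fun k : ℕ => m + 1 / ((k : ℝ) + 1)) atTop (𝓝 (m + 0)) :=
    tendsto_one_div_add_atTop_nhds_zero_nat.const_add m
  rw [add_zero] at hlim
  exact ge_of_tendsto' hlim fun k => (hu' k).2

/-- The classes in `L²[0, T]` of the admissible activity functions. -/
noncomputable def feasibleClasses (T a d s : ℝ) :
    Set (Lp ℝ 2 (volume.restrict (Set.Icc (0 : ℝ) T))) :=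
  Set.Icc 0 ((memLp_const (1 : ℝ)).toLp fun _ => 1) ∩
    {f | inner ℝ (indicatorConstLp 2 (measurableSet_Icc : MeasurableSet (Set.Icc a d))
      (measure_ne_top (volume.restrict (Set.Icc (0 : ℝ) T)) _) (1 : ℝ)) f = s}

lemma isClosed_feasibleClasses (T a d s : ℝ) : IsClosed (feasibleClasses T a d s) :=
  isClosed_Icc.inter (isClosed_eq (by fun_prop) continuous_const)

lemma mem_feasibleClasses_iff {T a d s : ℝ} (ha : 0 ≤ a) (had : a ≤ d) (hd : d ≤ T)
    {f : Lp ℝ 2 (volume.restrict (Set.Icc (0 : ℝ) T))} :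
    f ∈ feasibleClasses T a d s ↔
      ∃ x ∈ feasibleSet T a d s, f =ᵐ[volume.restrict (Set.Icc (0 : ℝ) T)] x := by
  have hsub : Set.Icc a d ⊆ Set.Icc 0 T := Set.Icc_subset_Icc ha hd
  have hint : ∀ x : ℝ → ℝ, f =ᵐ[volume.restrict (Set.Icc (0 : ℝ) T)] x →
      inner ℝ (indicatorConstLp 2 (measurableSet_Icc : MeasurableSet (Set.Icc a d))
        (measure_ne_top (volume.restrict (Set.Icc (0 : ℝ) T)) _) (1 : ℝ)) f =
      ∫ t in Set.Icc a d, x t := fun x hx => by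
    rw [L2.inner_indicatorConstLp_one, Measure.restrict_restrict measurableSet_Icc,
      Set.inter_eq_self_of_subset_left hsub]
    exact integral_congr_ae (ae_restrict_of_ae_restrict_of_subset hsub hx)
  have hone := (memLp_const (μ := volume.restrict (Set.Icc (0 : ℝ) T)) (p := 2)
    (1 : ℝ)).coeFn_toLp
  constructor
  · rintro ⟨⟨h0, h1⟩, hs⟩
    rw [← Lp.coeFn_nonneg] at h0
    rw [← Lp.coeFn_le] at h1
    -- A class is bounded only almost everywhere, while admissibility is pointwise; clipping gives a
    -- suitable representative.
    have hae : f =ᵐ[volume.restrict (Set.Icc (0 : ℝ) T)] fun t => max 0 (min 1 (f t)) := by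
      filter_upwards [h0, h1, hone] with t ht0 ht1 ht
      rw [ht] at ht1
      rw [min_eq_right ht1, max_eq_right (show 0 ≤ f t from ht0)]
    refine ⟨fun t => max 0 (min 1 (f t)), ?_, hae⟩
    refine mem_feasibleSet_of_setIntegral had
      ((Lp.aestronglyMeasurable f).aemeasurable.congr hae)
      (fun t _ => ⟨le_max_left _ _, max_le zero_le_one (min_le_left _ _)⟩) ?_
    rw [← hint _ hae]
    exact hs
  · rintro ⟨x, hx, hfx⟩
    have hmem : ∀ᵐ t ∂volume.restrict (Set.Icc (0 : ℝ) T), 0 ≤ x t ∧ x t ≤ 1 :=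
      (ae_restrict_iff' measurableSet_Icc).2 (Eventually.of_forall hx.2.1)
    refine ⟨⟨?_, ?_⟩, (hint x hfx).trans (integral_eq_setIntegral_of_mem_feasibleSet had hx)⟩
    · rw [← Lp.coeFn_nonneg]
      filter_upwards [hfx, hmem] with t h1 h2
      rw [h1]; exact h2.1
    · rw [← Lp.coeFn_le]
      filter_upwards [hfx, hmem, hone] with t h1 h2 h3
      rw [h1, h3]; exact h2.2

lemma exists_mem_feasibleClasses {T a d s : ℝ} (ha : 0 ≤ a) (had : a ≤ d) (hd : d ≤ T)
    {x : ℝ → ℝ} (hx : x ∈ feasibleSet T a d s) :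
    ∃ f ∈ feasibleClasses T a d s, f =ᵐ[volume.restrict (Set.Icc (0 : ℝ) T)] x := by
  have hmem : MemLp x 2 (volume.restrict (Set.Icc (0 : ℝ) T)) :=
    MemLp.of_bound hx.1.aestronglyMeasurable 1
      ((ae_restrict_iff' measurableSet_Icc).2 (Eventually.of_forall fun t ht => by
        rw [Real.norm_of_nonneg (hx.2.1 t ht).1]; exact (hx.2.1 t ht).2))
  exact ⟨hmem.toLp, (mem_feasibleClasses_iff ha had hd).2 ⟨x, hx, hmem.coeFn_toLp⟩,
    hmem.coeFn_toLp⟩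

lemma convex_feasibleClasses {T a d s : ℝ} (ha : 0 ≤ a) (had : a ≤ d) (hd : d ≤ T) :
    Convex ℝ (feasibleClasses T a d s) := by
  intro f hf g hg b c hb hc hbc
  rw [mem_feasibleClasses_iff ha had hd] at *
  obtain ⟨x, hx, hfx⟩ := hf
  obtain ⟨y, hy, hgy⟩ := hg
  refine ⟨_, lineMap_mem_feasibleSet ha had hd hx hy hc (by linarith), ?_⟩
  filter_upwards [hfx, hgy, Lp.coeFn_add (b • f) (c • g), Lp.coeFn_smul b f, Lp.coeFn_smul c g]
    with t h1 h2 h3 h4 h5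
  rw [h3, Pi.add_apply, h4, h5, Pi.smul_apply, Pi.smul_apply, h1, h2, ← hbc]
  simp

lemma norm_le_of_mem_feasibleClasses {T a d s : ℝ}
    {f : Lp ℝ 2 (volume.restrict (Set.Icc (0 : ℝ) T))} (hf : f ∈ feasibleClasses T a d s) :
    ‖f‖ ≤ ‖(memLp_const (1 : ℝ)).toLp (p := 2) (μ := volume.restrict (Set.Icc (0 : ℝ) T))
      fun _ => 1‖ := by
  have h0 := (Lp.coeFn_nonneg f).2 hf.1.1
  have h1 := (Lp.coeFn_le _ _).2 hf.1.2
  refine Lp.norm_le_norm_of_ae_le ?_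
  filter_upwards [h0, h1] with t ht0 ht1
  rw [Real.norm_of_nonneg ht0, Real.norm_of_nonneg (ht0.trans ht1)]
  exact ht1

section Existence

variable {N : ℕ} {T : ℝ} {a d s p : Fin N → ℝ}

/-- The load as a continuous linear map on `L²`. -/
noncomputable def loadL (T : ℝ) (p : Fin N → ℝ) :
    PiLp 2 (fun _ : Fin N => Lp ℝ 2 (volume.restrict (Set.Icc (0 : ℝ) T))) →L[ℝ]
      Lp ℝ 2 (volume.restrict (Set.Icc (0 : ℝ) T)) :=
  ∑ n, p n • PiLp.proj 2 _ n

/-- Turns the quadratic problem into minimizing the norm of a linear map; the `PiLp 2` product keeps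
the space of policies a Hilbert space. -/
lemma cost_sq_eq_norm_loadL (hT : 0 ≤ T) {X : Fin N → ℝ → ℝ}
    {u : PiLp 2 fun _ : Fin N => Lp ℝ 2 (volume.restrict (Set.Icc (0 : ℝ) T))}
    (hu : ∀ n, u n =ᵐ[volume.restrict (Set.Icc (0 : ℝ) T)] X n) :
    cost (fun v => v ^ 2) T (load p X) = ‖loadL T p u‖ ^ 2 := by
  have hL : loadL T p u = ∑ n, p n • u n := by
    simp [loadL]
  have hae : loadL T p u =ᵐ[volume.restrict (Set.Icc (0 : ℝ) T)] load p X := by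
    rw [hL]
    have h1 := Lp.coeFn_fun_finsetSum Finset.univ fun n => p n • u n
    have h2 := ae_all_iff.2 fun n => Lp.coeFn_smul (p n) (u n)
    filter_upwards [h1, h2, ae_all_iff.2 hu] with t h1 h2 h3
    rw [h1]
    exact Finset.sum_congr rfl fun n _ => by rw [h2, Pi.smul_apply, h3, smul_eq_mul]
  rw [← real_inner_self_eq_norm_sq, L2.inner_def, cost_eq hT]
  refine integral_congr_ae ?_
  filter_upwards [hae] with t ht
  simp [ht, sq]

lemma exists_feasible (hwin : ∀ n, 0 ≤ a n ∧ a n ≤ d n ∧ d n ≤ T)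
    (hs : ∀ n, 0 ≤ s n ∧ s n ≤ d n - a n) : ∃ X, IsFeasible T a d s X := by
  have : ∀ n, ∃ x, x ∈ feasibleSet T (a n) (d n) (s n) := fun n =>
    (exists_level (P := 0) (q := fun _ => 0) (hwin n).1 (hwin n).2.1 (hwin n).2.2 (hs n).1
      (hs n).2 one_pos ⟨aemeasurable_const, fun t _ => by simp⟩).imp fun x hx => hx.1
  choose X hX using this
  exact ⟨X, hX⟩

/-- The relaxed problem with quadratic cost has an optimal solution. -/
lemma exists_isOptimal_sq (hT : 0 ≤ T)
    (hwin : ∀ n, 0 ≤ a n ∧ a n ≤ d n ∧ d n ≤ T) (hs : ∀ n, 0 ≤ s n ∧ s n ≤ d n - a n) :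
    ∃ X, IsOptimal (fun u => u ^ 2) T a d s p X := by
  set K : Set (PiLp 2 fun _ : Fin N => Lp ℝ 2 (volume.restrict (Set.Icc (0 : ℝ) T))) :=
    {u | ∀ n, u n ∈ feasibleClasses T (a n) (d n) (s n)} with hK
  have hlift : ∀ X, IsFeasible T a d s X →
      ∃ u ∈ K, ∀ n, u n =ᵐ[volume.restrict (Set.Icc (0 : ℝ) T)] X n := fun X hX => by
    choose f hf hfX using fun n =>
      exists_mem_feasibleClasses (hwin n).1 (hwin n).2.1 (hwin n).2.2 (hX n)
    exact ⟨WithLp.toLp 2 f, hf, hfX⟩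
  obtain ⟨X₀, hX₀⟩ := exists_feasible hwin hs
  have hclosed : IsClosed K := by
    have : K = ⋂ n, {u | u n ∈ feasibleClasses T (a n) (d n) (s n)} := by
      ext u; simp [hK]
    rw [this]
    exact isClosed_iInter fun n =>
      (isClosed_feasibleClasses _ _ _ _).preimage (PiLp.continuous_apply 2 _ n)
  have hconv : Convex ℝ K := fun u hu v hv b c hb hc hbc n =>
    convex_feasibleClasses (hwin n).1 (hwin n).2.1 (hwin n).2.2 (hu n) (hv n) hb hc hbc
  have hbound : ∀ u ∈ K, ‖u‖ ≤ √(∑ _n : Fin N, ‖(memLp_const (1 : ℝ)).toLp (p := 2)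
      (μ := volume.restrict (Set.Icc (0 : ℝ) T)) fun _ => 1‖ ^ 2) := fun u hu => by
    rw [PiLp.norm_eq_of_L2]
    refine Real.sqrt_le_sqrt (Finset.sum_le_sum fun n _ => ?_)
    exact pow_le_pow_left₀ (norm_nonneg _) (norm_le_of_mem_feasibleClasses (hu n)) 2
  obtain ⟨u, hu, hmin⟩ := exists_norm_map_le (loadL T p) hclosed hconv
    ((hlift X₀ hX₀).imp fun u hu => hu.1) hbound
  choose X hX hXu using fun n =>
    (mem_feasibleClasses_iff (hwin n).1 (hwin n).2.1 (hwin n).2.2).1 (hu n)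
  refine ⟨X, hX, fun Y hY => ?_⟩
  obtain ⟨v, hv, hvY⟩ := hlift Y hY
  rw [cost_sq_eq_norm_loadL hT hXu, cost_sq_eq_norm_loadL hT hvY]
  exact pow_le_pow_left₀ (norm_nonneg _) (hmin v hv) 2

end Existence

end LoadBalancing

theorem theorem1 {N : ℕ} (T : ℝ) (hT : 0 ≤ T) (a d s p : Fin N → ℝ) (C : ℝ → ℝ)
    (hwin : ∀ n, 0 ≤ a n ∧ a n ≤ d n ∧ d n ≤ T)
    (hs : ∀ n, 0 ≤ s n ∧ s n ≤ d n - a n)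
    (hp : ∀ n, 0 ≤ p n)
    (hmono : MonotoneOn C (Set.Ici 0))
    (hconv : ConvexOn ℝ (Set.Ici 0) C)
    (hdiff : DifferentiableOn ℝ C (Set.Ici 0)) :
    -- the relaxed problem has an optimal solution
    (∃ Xopt, LoadBalancing.IsOptimal C T a d s p Xopt) ∧
    -- every step of the algorithm can be carried out
    (∀ X, LoadBalancing.IsFeasible T a d s X → ∀ n,
      ∃ x, LoadBalancing.IsBalancedUpdate C T a d s p X n x) ∧
    -- convergence, for every order that visits each task infinitely often
    ∀ i : ℕ → Fin N, (∀ n, ∃ᶠ k in atTop, i k = n) → ∀ X : ℕ → Fin N → ℝ → ℝ,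
      (LoadBalancing.IsRun C T a d s p i X →
        (∀ Xopt, LoadBalancing.IsOptimal C T a d s p Xopt →
          Tendsto (fun k => LoadBalancing.cost C T (LoadBalancing.load p (X k))) atTop
            (𝓝 (LoadBalancing.cost C T (LoadBalancing.load p Xopt)))) ∧
        (StrictConvexOn ℝ (Set.Ici 0) C →
          ∀ Xopt, LoadBalancing.IsOptimal C T a d s p Xopt →
            LoadBalancing.LoadsTendsto T (fun k => LoadBalancing.load p (X k))
              (LoadBalancing.load p Xopt))) ∧
      (LoadBalancing.IsBalancedRun C T a d s p i X →
        ∃ Xopt, LoadBalancing.IsOptimal C T a d s p Xopt ∧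
          LoadBalancing.LoadsTendsto T (fun k => LoadBalancing.load p (X k))
            (LoadBalancing.load p Xopt)) := by
  have h := LoadBalancing.isSubgradient_derivWithin hmono hconv hdiff
  obtain ⟨Xq, hXq⟩ := LoadBalancing.exists_isOptimal_sq (p := p) hT hwin hs
  have hXC := hXq.of_sq h hT hp hwin hs
  refine ⟨⟨Xq, hXC⟩, fun X hX n => LoadBalancing.exists_isBalancedUpdate h hT hp hwin hs hX n,
    fun i hi X => ⟨fun hX => ⟨fun Y hY => hX.tendsto_cost h hT hp hwin hi hY,
      fun hC Y hY => hX.loadsTendsto h hC hT hp hwin hi hY⟩, fun hX => ⟨Xq, hXC, ?_⟩⟩⟩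
  -- The limit load is that of the quadratic optimum, whatever `C` is.
  exact (hX.isRun_sq h hT hp hwin hs).loadsTendsto LoadBalancing.isSubgradient_sq
    LoadBalancing.strictConvexOn_sq hT hp hwin hi hXq
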